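/- Let $m\ge 1$, let $k_1,\dots,k_m\ge 1$ be integers, $n=k_1+\dots+k_m$, and let $\lambda>-1$. Let $\mathbb B^n$ be the unit ball of $\mathbb C^n=\mathbb C^{k_1}\times\dots\times\mathbb C^{k_m}$, and write $u=(u_{(1)},\dots,u_{(m)})$, $u_{(j)}=(u_{j,1},\dots,u_{j,k_j})$ for $n$-tuples $u$, and $|u_{(j)}|=\sum_{\ell}u_{j,\ell}$, $|u|=\sum_j|u_{(j)}|$ for tuples of integers. Let $\mathcal A^2_\lambda$ be the space of holomorphic functions in $L_2(\mathbb B^n,dv_\lambda)$, where $dv_\lambda(z)=\frac{\Gamma(n+\lambda+1)}{\pi^n\Gamma(\lambda+1)}(1-|z|^2)^\lambda dv(z)$ and $dv$ is Lebesgue measure. For $\varphi\in L_\infty(\mathbb B^n)$ let $T_\varphi f=B_\lambda(\varphi f)$, $f\in\mathcal A^2_\lambda$, where $B_\lambda$ is the orthogonal projection of $L_2(\mathbb B^n,dv_\lambda)$ onto $\mathcal A^2_\lambda$; $\langle\cdot,\cdot\rangle$ is the inner product of $\mathcal A^2_\lambda$, linear in the first variable. For $z\in\mathbb B^n$ put $r_j=(\sum_\ell|z_{j,\ell}|^2)^{1/2}$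 and, for almost every $z$, $s_{j,\ell}=|z_{j,\ell}|/r_j$ and $t_{j,\ell}=z_{j,\ell}/|z_{j,\ell}|$. Let $a=a(r_1,\dots,r_m)$ be a $k$-quasi-radial function, i.e. an element of $L_\infty(\mathbb B^n)$ which depends only on $r_1,\dots,r_m$. For every $j$ let $c_j\in L_\infty(S_+^{k_j-1}\times\mathbb T^{k_j})$ be generalized pseudo-homogeneous, i.e. $c_j(s_{(j)},g\,t_{(j)})=c_j(s_{(j)},t_{(j)})$ for all $g\in\mathbb T$, where $S_+^{k_j-1}$ is the set of points of the unit sphere of $\mathbb R^{k_j}$ with non-negative entries, $\mathbb T$ is the unit circle, and $g$ multiplies every entry of $t_{(j)}$. Let $c(z)=\prod_{j=1}^m c_j(s_{(j)},t_{(j)})$. For $p_{(j)}\in\mathbb Z^{k_j}$ let $$\hat c_j(s_{(j)},p_{(j)})=\int_{\mathbb T^{k_j}}c_j(s_{(j)},t_{(j)})\,t_{(j)}^{-p_{(j)}}\,d\mu_j(t_{(j)}),$$ with $\mu_j$ the invariant probability measure of $\mathbb T^{k_j}$, and let $\Delta_d=\{r\in\mathbb R_+^d: r_1+\dots+r_d\le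 1\}$. Then $ac\in L_\infty(\mathbb B^n)$, and: 1. For all $\alpha,\beta\in\mathbb Z_+^n$, $\langle T_{ac}z^\alpha,z^\beta\rangle=0$ if $|\alpha_{(j)}|\ne|\beta_{(j)}|$ for some $j$. 2. For every $p\in\mathbb Z^n$ with $|p_{(j)}|=0$ for $j=1,\dots,m$, and every $\alpha\in\mathbb Z_+^n$ with $\alpha+p\in\mathbb Z_+^n$, $$\begin{aligned}\langle T_{ac}z^\alpha,z^{\alpha+p}\rangle={}&\frac{\Gamma(n+\lambda+1)\prod_{j,\ell}\Gamma(\alpha_{j,\ell}+p_{j,\ell}+1)}{\Gamma(n+|\alpha|+\lambda+1)}\cdot\frac{\Gamma(n+|\alpha|+\lambda+1)}{\Gamma(\lambda+1)\prod_{j=1}^m\Gamma(|\alpha_{(j)}|+k_j)}\\&\times\int_{\Delta_m}a(\sqrt{r_1},\dots,\sqrt{r_m})\prod_{j=1}^m r_j^{|\alpha_{(j)}|+k_j-1}\,(1-(r_1+\dots+r_m))^\lambda\,dr_1\cdots dr_m\\&\times\prod_{j=1}^m\frac{\Gamma(|\alpha_{(j)}|+k_j)}{\prod_{\ell=1}^{k_j}\Gamma(\alpha_{j,\ell}+p_{j,\ell}+1)}\int_{\Delta_{k_j-1}}\hat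 c_j(s_{(j)}^{1/2},p_{(j)})\prod_{\ell=1}^{k_j}s_{j,\ell}^{\alpha_{j,\ell}+\frac12p_{j,\ell}}\,ds_{j,1}\cdots ds_{j,k_j-1},\end{aligned}$$ where $s_{j,k_j}=1-(s_{j,1}+\dots+s_{j,k_j-1})$ and $s_{(j)}^{1/2}=(s_{j,1}^{1/2},\dots,s_{j,k_j}^{1/2})$. The first factor on the right-hand side equals $\|z^{\alpha+p}\|^2$. -/

import Mathlib

open MeasureTheory Filter Topology
open scoped ENNReal

namespace BergmanBall

/-! ### The unit ball and the weighted Bergman space -/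

section Bergman

variable (ι : Type*) [Fintype ι] (lam : ℝ)

/-- The open Euclidean unit ball of `ℂ^ι`. -/
def unitBall : Set (ι → ℂ) := {z | ∑ i, ‖z i‖ ^ 2 < 1}

/-- The constant `c_λ = Γ(n + λ + 1) / (π^n Γ(λ + 1))`, where `n` is the cardinality of `ι`. -/
noncomputable def normConst : ℝ :=
  Real.Gamma (Fintype.card ι + lam + 1) / (Real.pi ^ Fintype.card ι * Real.Gamma (lam + 1))

/-- The measure `dv_λ(z) = c_λ (1 - |z|²)^λ dv(z)` on the unit ball, with `dv` Lebesgue measure. -/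
noncomputable def weightedMeasure : Measure (ι → ℂ) :=
  (volume.restrict (unitBall ι)).withDensity
    fun z => ENNReal.ofReal (normConst ι lam * (1 - ∑ i, ‖z i‖ ^ 2) ^ lam)

/-- The weighted Bergman space: the elements of `L²(dv_λ)` that are represented by a function
which is holomorphic on the unit ball. -/
noncomputable def bergman : Submodule ℂ (Lp ℂ 2 (weightedMeasure ι lam)) where
  carrier := {f | ∃ g : (ι → ℂ) → ℂ, DifferentiableOn ℂ g (unitBall ι) ∧
    f =ᵐ[weightedMeasure ι lam] g}
  zero_mem' := ⟨0, differentiableOn_const 0, Lp.coeFn_zero _ _ _⟩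
  add_mem' := by
    rintro f₁ f₂ ⟨g₁, h₁, e₁⟩ ⟨g₂, h₂, e₂⟩
    exact ⟨g₁ + g₂, h₁.add h₂, (Lp.coeFn_add f₁ f₂).trans (e₁.add e₂)⟩
  smul_mem' := by
    rintro c f ⟨g, h, e⟩
    exact ⟨c • g, h.const_smul c, (Lp.coeFn_smul c f).trans (e.const_smul c)⟩

variable {ι}

lemma isOpen_unitBall : IsOpen (unitBall ι) :=
  isOpen_lt (by fun_prop) continuous_const

lemma measurableSet_unitBall : MeasurableSet (unitBall ι) := isOpen_unitBall.measurableSet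

lemma measurable_density :
    Measurable fun z : ι → ℂ =>
      ENNReal.ofReal (normConst ι lam * (1 - ∑ i, ‖z i‖ ^ 2) ^ lam) := by
  fun_prop

/-- Mean value property of holomorphic functions over a polydisc. -/
lemma meanValue {g : (ι → ℂ) → ℂ} {U : Set (ι → ℂ)}
    (hg : DifferentiableOn ℂ g U) {z : ι → ℂ} {r : ℝ} (hz : Metric.closedBall z r ⊆ U) :
    ∫ w in Metric.closedBall (0 : ι → ℂ) r, g (z + w) =
      (volume (Metric.closedBall (0 : ι → ℂ) r)).toReal • g z := by
  set B := Metric.closedBall (0 : ι → ℂ) r with hB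
  have hmem : ∀ u : ℂ, ‖u‖ ≤ 1 → ∀ w ∈ B, z + u • w ∈ U := by
    intro u hu w hw
    apply hz
    rw [hB, mem_closedBall_zero_iff] at hw
    rw [Metric.mem_closedBall, dist_eq_norm, add_sub_cancel_left, norm_smul]
    nlinarith [norm_nonneg w, norm_nonneg u]
  have hcirc : ∀ θ : ℝ, ‖circleMap 0 1 θ‖ = 1 := by intro θ; simp
  have havg : ∀ w ∈ B, (2 * Real.pi)⁻¹ •
      ∫ θ in Set.Ioc 0 (2 * Real.pi), g (z + circleMap 0 1 θ • w) = g z := by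
    intro w hw
    have hd : DiffContOnCl ℂ (fun u : ℂ => g (z + u • w)) (Metric.ball 0 |(1 : ℝ)|) := by
      apply DifferentiableOn.diffContOnCl
      rw [abs_one, closure_ball _ one_ne_zero]
      exact hg.comp (by fun_prop) fun u hu => hmem u (by simpa using hu) w hw
    have := hd.circleAverage
    rw [Real.circleAverage_def, intervalIntegral.integral_of_le Real.two_pi_pos.le] at this
    simpa using this
  have hrot : ∀ θ : ℝ, ∫ w in B, g (z + circleMap 0 1 θ • w) = ∫ w in B, g (z + w) := by
    intro θ
    set u := circleMap 0 1 θ with hu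
    have hu0 : u ≠ 0 := by rw [← norm_pos_iff, hcirc]; exact one_pos
    have hmp : MeasurePreserving (fun w : ι → ℂ => u • w) volume volume := by
      have h1 : MeasurePreserving (rotation (Circle.exp θ)) (volume : Measure ℂ) volume :=
        (rotation (Circle.exp θ)).measurePreserving
      have h2 : MeasurePreserving (fun (a : ι → ℂ) (i : ι) => rotation (Circle.exp θ) (a i))
          volume volume := volume_preserving_pi fun _ => h1
      convert h2 using 2 with w
      ext i
      simp [hu, circleMap, rotation_apply]
    have hpre : (fun w : ι → ℂ => u • w) ⁻¹' B = B := by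
      ext w
      simp [hB, norm_smul, hu, hcirc]
    have := hmp.setIntegral_preimage_emb
      (Homeomorph.smulOfNeZero u hu0).measurableEmbedding (fun w => g (z + w)) B
    rw [hpre] at this
    exact this
  have hint : Integrable (Function.uncurry fun (w : ι → ℂ) (θ : ℝ) => g (z + circleMap 0 1 θ • w))
      ((volume.restrict B).prod (volume.restrict (Set.Ioc 0 (2 * Real.pi)))) := by
    rw [Measure.prod_restrict]
    have hc : ContinuousOn (Function.uncurry fun (w : ι → ℂ) (θ : ℝ) =>
        g (z + circleMap 0 1 θ • w)) (B ×ˢ Set.Icc 0 (2 * Real.pi)) := by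
      refine hg.continuousOn.comp (Continuous.continuousOn ?_) ?_
      · have := continuous_circleMap 0 1
        fun_prop
      · rintro ⟨w, θ⟩ ⟨hw, -⟩
        exact hmem _ (hcirc θ).le w hw
    have hK : IsCompact (B ×ˢ Set.Icc 0 (2 * Real.pi)) :=
      (isCompact_closedBall _ _).prod isCompact_Icc
    have h3 : IntegrableOn (Function.uncurry fun (w : ι → ℂ) (θ : ℝ) =>
        g (z + circleMap 0 1 θ • w)) (B ×ˢ Set.Icc 0 (2 * Real.pi))
        ((volume : Measure (ι → ℂ)).prod (volume : Measure ℝ)) := hc.integrableOn_compact hK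
    exact h3.mono_set (Set.prod_mono subset_rfl Set.Ioc_subset_Icc_self)
  have hBm : MeasurableSet B := Metric.isClosed_closedBall.measurableSet
  calc ∫ w in B, g (z + w)
      = (2 * Real.pi)⁻¹ • ∫ θ in Set.Ioc 0 (2 * Real.pi), ∫ w in B,
          g (z + circleMap 0 1 θ • w) := by
        simp_rw [hrot]
        have h4 : (2 * Real.pi)⁻¹ * volume.real (Set.Ioc 0 (2 * Real.pi)) = 1 := by
          rw [Real.volume_real_Ioc_of_le Real.two_pi_pos.le, sub_zero]
          exact inv_mul_cancel₀ Real.two_pi_pos.ne'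
        rw [setIntegral_const, smul_smul, h4, one_smul]
    _ = (2 * Real.pi)⁻¹ • ∫ w in B, ∫ θ in Set.Ioc 0 (2 * Real.pi),
          g (z + circleMap 0 1 θ • w) := by
        rw [integral_integral_swap hint]
    _ = ∫ w in B, g z := by
        rw [← integral_smul]
        exact setIntegral_congr_fun hBm havg
    _ = _ := by
        rw [setIntegral_const]
        rfl

/-- Point evaluations are locally uniformly bounded on the Bergman space. -/
lemma exists_eval_bound (hc : 0 < normConst ι lam) {z₀ : ι → ℂ} (hz₀ : z₀ ∈ unitBall ι) :
    ∃ r : ℝ, 0 < r ∧ Metric.closedBall z₀ r ⊆ unitBall ι ∧ ∃ C : ℝ≥0∞, C ≠ ∞ ∧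
      ∀ g : (ι → ℂ) → ℂ, DifferentiableOn ℂ g (unitBall ι) →
        ∀ z ∈ Metric.closedBall z₀ r, ‖g z‖ₑ ≤ C * eLpNorm g 2 (weightedMeasure ι lam) := by
  obtain ⟨R, hR, hRU⟩ := Metric.nhds_basis_closedBall.mem_iff.1 (isOpen_unitBall.mem_nhds hz₀)
  set K := Metric.closedBall z₀ R with hK
  have hKc : IsCompact K := isCompact_closedBall _ _
  have hKm : MeasurableSet K := Metric.isClosed_closedBall.measurableSet
  set d : (ι → ℂ) → ℝ := fun z => normConst ι lam * (1 - ∑ i, ‖z i‖ ^ 2) ^ lam with hd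
  have hdpos : ∀ z ∈ K, 0 < d z := fun z hz =>
    mul_pos hc (Real.rpow_pos_of_pos (sub_pos.2 (hRU hz)) _)
  have hdc : ContinuousOn d K := by
    refine continuousOn_const.mul (ContinuousOn.rpow_const (by fun_prop) fun z hz => ?_)
    exact Or.inl (sub_pos.2 (hRU hz)).ne'
  obtain ⟨y, hy, hymin⟩ := hKc.exists_isMinOn ⟨z₀, Metric.mem_closedBall_self hR.le⟩ hdc
  set δ := ENNReal.ofReal (d y) with hδ
  have hδ0 : δ ≠ 0 := (ENNReal.ofReal_pos.2 (hdpos y hy)).ne'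
  have hδt : δ ≠ ∞ := ENNReal.ofReal_ne_top
  have hle : volume.restrict K ≤ δ⁻¹ • weightedMeasure ι lam := by
    refine Measure.le_iff.2 fun s hs => ?_
    rw [Measure.smul_apply, smul_eq_mul, ← ENNReal.mul_le_iff_le_inv hδ0 hδt,
      weightedMeasure, withDensity_apply _ hs, Measure.restrict_apply hs,
      Measure.restrict_restrict hs]
    calc δ * volume (s ∩ K) = ∫⁻ _ in s ∩ K, δ := by rw [setLIntegral_const]
      _ ≤ ∫⁻ z in s ∩ K, ENNReal.ofReal (d z) :=
        setLIntegral_mono' (hs.inter hKm) fun z hz => ENNReal.ofReal_le_ofReal (hymin hz.2)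
      _ ≤ ∫⁻ z in s ∩ unitBall ι, ENNReal.ofReal (d z) :=
        lintegral_mono_set (Set.inter_subset_inter_right _ hRU)
  set V := volume (Metric.closedBall (0 : ι → ℂ) (R / 2)) with hV
  have hV0 : V ≠ 0 := (Metric.measure_closedBall_pos volume _ (half_pos hR)).ne'
  have hVt : V ≠ ∞ := measure_closedBall_lt_top.ne
  have hKt : volume K ≠ ∞ := measure_closedBall_lt_top.ne
  refine ⟨R / 2, half_pos hR, (Metric.closedBall_subset_closedBall (by linarith)).trans hRU,
    V⁻¹ * ((δ⁻¹) ^ (1 / (2 : ℝ≥0∞)).toReal * (volume K) ^ (1 / (2 : ℝ))), ?_, ?_⟩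
  · refine ENNReal.mul_ne_top (ENNReal.inv_ne_top.2 hV0) (ENNReal.mul_ne_top ?_ ?_)
    · exact ENNReal.rpow_ne_top_of_nonneg (by simp) (ENNReal.inv_ne_top.2 hδ0)
    · exact ENNReal.rpow_ne_top_of_nonneg (by simp) hKt
  intro g hg z hz
  have hzK : Metric.closedBall z (R / 2) ⊆ K := by
    refine Metric.closedBall_subset_closedBall' ?_
    have := Metric.mem_closedBall.1 hz
    linarith
  have hgK : AEStronglyMeasurable g (volume.restrict K) :=
    (hg.continuousOn.mono hRU).aestronglyMeasurable hKm
  have h1 : V * ‖g z‖ₑ ≤ eLpNorm g 1 (volume.restrict K) := by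
    have hmv := meanValue hg (hzK.trans hRU)
    have : V * ‖g z‖ₑ = ‖V.toReal • g z‖ₑ := by
      rw [enorm_smul, Real.enorm_of_nonneg ENNReal.toReal_nonneg, ENNReal.ofReal_toReal hVt]
    rw [this, ← hmv, eLpNorm_one_eq_lintegral_enorm]
    refine (enorm_integral_le_lintegral_enorm _).trans ?_
    have hpre : (fun w : ι → ℂ => z + w) ⁻¹' Metric.closedBall z (R / 2) =
        Metric.closedBall 0 (R / 2) := by
      ext w
      simp
    have hmp : MeasurePreserving (fun w : ι → ℂ => z + w) volume volume :=
      measurePreserving_add_left volume z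
    have := hmp.setLIntegral_comp_preimage_emb (measurableEmbedding_addLeft z)
      (fun w => ‖g w‖ₑ) (Metric.closedBall z (R / 2))
    rw [hpre] at this
    rw [this]
    exact lintegral_mono_set hzK
  have h2 : eLpNorm g 1 (volume.restrict K) ≤
      eLpNorm g 2 (volume.restrict K) * (volume K) ^ (1 / (2 : ℝ)) := by
    have := eLpNorm_le_eLpNorm_mul_rpow_measure_univ (p := 1) (q := 2) (by norm_num) hgK
    refine this.trans_eq ?_
    rw [Measure.restrict_apply_univ]
    norm_num
  have h3 : eLpNorm g 2 (volume.restrict K) ≤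
      (δ⁻¹) ^ (1 / (2 : ℝ≥0∞)).toReal * eLpNorm g 2 (weightedMeasure ι lam) := by
    refine (eLpNorm_mono_measure g hle).trans_eq ?_
    rw [eLpNorm_smul_measure_of_ne_top (by norm_num), smul_eq_mul]
  rw [mul_assoc, ← ENNReal.mul_le_iff_le_inv hV0 hVt]
  refine (h1.trans (h2.trans (mul_le_mul_left h3 _))).trans_eq ?_
  ring

lemma exists_locallyUniform_limit {X Y Z : Type*} [TopologicalSpace X] [NormedAddCommGroup Y]
    [CompleteSpace Y] [PseudoMetricSpace Z] {U : Set X} (u : ℕ → X → Y) {F : ℕ → Z}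
    (hF : CauchySeq F)
    (h : ∀ x ∈ U, ∃ s ∈ 𝓝 x, ∃ C : ℝ, ∀ n m, ∀ y ∈ s, ‖u n y - u m y‖ ≤ C * dist (F n) (F m)) :
    ∃ L : X → Y, TendstoLocallyUniformlyOn u L atTop U := by
  have hcauchy : ∀ x ∈ U, ∃ s ∈ 𝓝 x, UniformCauchySeqOn u atTop s := by
    intro x hx
    obtain ⟨s, hs, C, hC⟩ := h x hx
    refine ⟨s, hs, Metric.uniformCauchySeqOn_iff.2 fun ε hε => ?_⟩
    obtain ⟨N, hN⟩ := Metric.cauchySeq_iff.1 hF (ε / (|C| + 1)) (by positivity)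
    refine ⟨N, fun n hn m hm y hy => ?_⟩
    rw [dist_eq_norm]
    have h1 := hC n m y hy
    have h2 := hN n hn m hm
    rw [lt_div_iff₀ (by positivity)] at h2
    nlinarith [le_abs_self C, dist_nonneg (x := F n) (y := F m)]
  have hlim : ∀ x, ∃ l, x ∈ U → Tendsto (fun n => u n x) atTop (𝓝 l) := by
    intro x
    by_cases hx : x ∈ U
    · obtain ⟨s, hs, hsc⟩ := hcauchy x hx
      obtain ⟨l, hl⟩ := cauchySeq_tendsto_of_complete (hsc.cauchySeq (mem_of_mem_nhds hs))
      exact ⟨l, fun _ => hl⟩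
    · exact ⟨0, fun h => absurd h hx⟩
  choose L hL using hlim
  refine ⟨L, fun v hv x hx => ?_⟩
  obtain ⟨s, hs, hsc⟩ := hcauchy x hx
  have hsc' : UniformCauchySeqOn u atTop (s ∩ U) := hsc.mono Set.inter_subset_left
  refine ⟨s ∩ U, inter_mem (mem_nhdsWithin_of_mem_nhds hs) self_mem_nhdsWithin, ?_⟩
  exact hsc'.tendstoUniformlyOn_of_tendsto (fun y hy => hL y hy.2) v hv

variable (ι)

/-- The Bergman space is closed in `L²(dv_λ)`. -/
lemma isClosed_bergman : IsClosed (bergman ι lam : Set (Lp ℂ 2 (weightedMeasure ι lam))) := by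
  rcases lt_or_ge 0 (normConst ι lam) with hc | hc
  swap
  · have h0 : weightedMeasure ι lam = 0 := by
      rw [weightedMeasure, withDensity_eq_zero_iff]
      · refine (ae_restrict_iff' measurableSet_unitBall).2 (ae_of_all _ fun z hz => ?_)
        have : (0 : ℝ) < 1 - ∑ i, ‖z i‖ ^ 2 := sub_pos.2 hz
        exact ENNReal.ofReal_of_nonpos
          (mul_nonpos_of_nonpos_of_nonneg hc (Real.rpow_nonneg this.le _))
      · exact (measurable_density lam).aemeasurable
    have : (bergman ι lam : Set (Lp ℂ 2 (weightedMeasure ι lam))) = Set.univ := by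
      refine Set.eq_univ_of_forall fun f => ⟨0, differentiableOn_const 0, ?_⟩
      rw [Filter.EventuallyEq, ae_eq_bot.2 h0]
      exact eventually_bot
    rw [this]
    exact isClosed_univ
  refine IsSeqClosed.isClosed fun F f hF hf => ?_
  choose g hg he using hF
  have hnorm : ∀ n m, eLpNorm (g n - g m) 2 (weightedMeasure ι lam) =
      ENNReal.ofReal (dist (F n) (F m)) := by
    intro n m
    rw [← edist_dist, Lp.edist_def]
    exact eLpNorm_congr_ae ((he n).symm.sub (he m).symm)
  have hbound : ∀ z₀ ∈ unitBall ι, ∃ r : ℝ, 0 < r ∧ Metric.closedBall z₀ r ⊆ unitBall ι ∧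
      ∃ C : ℝ, ∀ n m, ∀ z ∈ Metric.closedBall z₀ r, ‖g n z - g m z‖ ≤ C * dist (F n) (F m) := by
    intro z₀ hz₀
    obtain ⟨r, hr, hrU, C, hCt, hC⟩ := exists_eval_bound lam hc hz₀
    refine ⟨r, hr, hrU, C.toReal, fun n m z hz => ?_⟩
    have := hC (g n - g m) ((hg n).sub (hg m)) z hz
    rw [hnorm, ← ENNReal.ofReal_toReal hCt, ← ENNReal.ofReal_mul ENNReal.toReal_nonneg,
      Pi.sub_apply, ← ofReal_norm,
      ENNReal.ofReal_le_ofReal_iff (mul_nonneg ENNReal.toReal_nonneg dist_nonneg)] at this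
    exact this
  obtain ⟨G, hG⟩ := exists_locallyUniform_limit (U := unitBall ι) g hf.cauchySeq fun z hz => by
    obtain ⟨r, hr, -, C, hC⟩ := hbound z hz
    exact ⟨_, Metric.closedBall_mem_nhds z hr, C, hC⟩
  obtain ⟨G', hG'⟩ := exists_locallyUniform_limit (U := unitBall ι)
      (fun n z => fderiv ℂ (g n) z) hf.cauchySeq fun z₀ hz₀ => by
    obtain ⟨r, hr, hrU, C, hC⟩ := hbound z₀ hz₀
    refine ⟨_, Metric.ball_mem_nhds z₀ (half_pos hr), 2 * C / (r / 2), fun n m z hz => ?_⟩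
    have hsub : Metric.ball z (r / 2) ⊆ Metric.closedBall z₀ r := by
      intro w hw
      have h1 := Metric.mem_ball.1 hw
      have h2 := Metric.mem_ball.1 hz
      have h3 := dist_triangle w z z₀
      exact Metric.mem_closedBall.2 (by linarith)
    have hzz : z ∈ Metric.ball z (r / 2) := Metric.mem_ball_self (half_pos hr)
    have hzU : unitBall ι ∈ 𝓝 z := isOpen_unitBall.mem_nhds (hrU (hsub hzz))
    have hfd : fderiv ℂ (g n) z - fderiv ℂ (g m) z = fderiv ℂ (g n - g m) z :=
      (fderiv_sub ((hg n).differentiableAt hzU) ((hg m).differentiableAt hzU)).symm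
    rw [hfd]
    refine (Complex.norm_fderiv_le_div_of_mapsTo_ball (R₁ := r / 2)
      (R₂ := 2 * (C * dist (F n) (F m)))
      (((hg n).sub (hg m)).mono (hsub.trans hrU)) ?_ (half_pos hr)).trans_eq (by ring)
    intro w hw
    rw [Metric.mem_closedBall, dist_eq_norm]
    have h1 := hC n m w (hsub hw)
    have h2 := hC n m z (hsub hzz)
    refine (norm_sub_le _ _).trans ?_
    simp only [Pi.sub_apply]
    linarith
  refine ⟨G, fun z hz => ?_, ?_⟩
  · refine (hasFDerivAt_of_tendstoLocallyUniformlyOn isOpen_unitBall hG' (fun n x hx => ?_)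
      (fun x hx => hG.tendsto_at hx) hz).differentiableAt.differentiableWithinAt
    exact ((hg n).differentiableAt (isOpen_unitBall.mem_nhds hx)).hasFDerivAt
  · obtain ⟨φ, hφ, hlim⟩ := (tendstoInMeasure_of_tendsto_Lp hf).exists_seq_tendsto_ae
    have hmem : ∀ᵐ z ∂weightedMeasure ι lam, z ∈ unitBall ι :=
      (withDensity_absolutelyContinuous _ _).ae_le (ae_restrict_mem measurableSet_unitBall)
    filter_upwards [hlim, hmem, ae_all_iff.2 he] with z h1 h2 h3
    refine tendsto_nhds_unique h1 ?_
    simp_rw [h3]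
    exact (hG.tendsto_at h2).comp hφ.tendsto_atTop

instance : CompleteSpace (bergman ι lam) :=
  (isClosed_bergman ι lam).completeSpace_coe

variable {lam}

lemma integrableOn_radial (hlam : -1 < lam) (d : ℕ) :
    IntegrableOn (fun y : ℝ => y ^ d * (Set.Iio (1 : ℝ)).indicator (fun y => (1 - y ^ 2) ^ lam) y)
      (Set.Ioi 0) := by
  have h1 : IntegrableOn (fun y : ℝ => (1 - y) ^ lam) (Set.Ioo 0 1) := by
    have := (intervalIntegral.intervalIntegrable_rpow' (a := 0) (b := 1) hlam).comp_sub_left 1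
    simp only [sub_zero, sub_self] at this
    exact ((intervalIntegrable_iff_integrableOn_Ioc_of_le zero_le_one).1 this.symm).mono_set
      Set.Ioo_subset_Ioc_self
  have h2 : ContinuousOn (fun y : ℝ => y ^ d * (1 + y) ^ lam) (Set.Icc 0 1) := by
    refine (by fun_prop : ContinuousOn (fun y : ℝ => y ^ d) _).mul
      (ContinuousOn.rpow_const (by fun_prop) fun y hy => Or.inl ?_)
    have := hy.1
    positivity
  have h3 : IntegrableOn (fun y : ℝ => (y ^ d * (1 + y) ^ lam) * (1 - y) ^ lam) (Set.Icc 0 1) := by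
    refine IntegrableOn.continuousOn_mul h2 ?_ isCompact_Icc
    rwa [integrableOn_Icc_iff_integrableOn_Ioo]
  have h4 : IntegrableOn ((Set.Iio (1 : ℝ)).indicator fun y : ℝ => y ^ d * (1 - y ^ 2) ^ lam)
      (Set.Ioi 0) := by
    rw [integrableOn_indicator_iff measurableSet_Iio, Set.inter_comm, Set.Ioi_inter_Iio]
    refine (h3.mono_set Set.Ioo_subset_Icc_self).congr_fun (fun y hy => ?_) measurableSet_Ioo
    have : (1 - y ^ 2) = (1 + y) * (1 - y) := by ring
    simp only
    rw [this, Real.mul_rpow (by linarith [hy.1]) (by linarith [hy.2]), mul_assoc]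
  refine h4.congr_fun (fun y _ => ?_) measurableSet_Ioi
  by_cases hy : y ∈ Set.Iio (1 : ℝ) <;> simp [hy]

lemma integrableOn_density (hlam : -1 < lam) :
    IntegrableOn (fun z : ι → ℂ => (1 - ∑ i, ‖z i‖ ^ 2) ^ lam) (unitBall ι) := by
  rcases isEmpty_or_nonempty ι with hι | hι
  · have : IsFiniteMeasure (volume : Measure (ι → ℂ)) := by
      rw [volume_pi, Measure.pi_of_empty]
      infer_instance
    simp
  let e : EuclideanSpace ℂ ι ≃L[ℝ] (ι → ℂ) := PiLp.continuousLinearEquiv 2 ℝ fun _ => ℂ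
  have hnorm : ∀ z : ι → ℂ, ‖e.symm z‖ ^ 2 = ∑ i, ‖z i‖ ^ 2 := fun z => by
    rw [EuclideanSpace.norm_sq_eq]
    rfl
  let μ : Measure (EuclideanSpace ℂ ι) := (volume : Measure (ι → ℂ)).map e.symm
  have hμ : μ.IsAddHaarMeasure := e.symm.isAddHaarMeasure_map volume
  have hfin : FiniteDimensional ℝ (EuclideanSpace ℂ ι) := e.symm.finiteDimensional
  have h1 : Integrable (fun x : EuclideanSpace ℂ ι =>
      (Set.Iio (1 : ℝ)).indicator (fun y => (1 - y ^ 2) ^ lam) ‖x‖) μ :=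
    (integrable_fun_norm_addHaar μ).2 (integrableOn_radial hlam _)
  have h2 := (e.symm.toHomeomorph.measurableEmbedding.integrable_map_iff).1 h1
  refine (integrable_indicator_iff measurableSet_unitBall).1 (h2.congr (ae_of_all _ fun z => ?_))
  have hiff : ‖e.symm z‖ ∈ Set.Iio (1 : ℝ) ↔ z ∈ unitBall ι := by
    rw [unitBall, Set.mem_ofPred_eq, ← hnorm, Set.mem_Iio, sq_lt_one_iff₀ (norm_nonneg _)]
  have hnorm' := hnorm z
  simp only [Function.comp_apply, Set.indicator, ← hiff, ← hnorm]
  rfl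

lemma isFiniteMeasure_weightedMeasure (hlam : -1 < lam) :
    IsFiniteMeasure (weightedMeasure ι lam) := by
  refine isFiniteMeasure_withDensity_ofReal ?_
  exact ((integrableOn_density ι hlam).const_mul _).2

variable {ι}

lemma memLp_monomial (hlam : -1 < lam) (α : ι → ℕ) :
    MemLp (fun z : ι → ℂ => ∏ i, z i ^ α i) 2 (weightedMeasure ι lam) := by
  have := isFiniteMeasure_weightedMeasure ι hlam
  refine MemLp.of_bound (Continuous.aestronglyMeasurable (by fun_prop)) 1 ?_
  have hmem : ∀ᵐ z ∂weightedMeasure ι lam, z ∈ unitBall ι :=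
    (withDensity_absolutelyContinuous _ _).ae_le (ae_restrict_mem measurableSet_unitBall)
  filter_upwards [hmem] with z hz
  rw [norm_prod]
  refine Finset.prod_le_one (fun i _ => norm_nonneg _) fun i _ => ?_
  rw [norm_pow]
  refine pow_le_one₀ (norm_nonneg _) ?_
  have h1 : ‖z i‖ ^ 2 ≤ ∑ i, ‖z i‖ ^ 2 :=
    Finset.single_le_sum (f := fun i => ‖z i‖ ^ 2) (fun _ _ => sq_nonneg _) (Finset.mem_univ i)
  exact (sq_lt_one_iff₀ (norm_nonneg _)).1 (h1.trans_lt hz) |>.le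

lemma differentiable_monomial (α : ι → ℕ) :
    Differentiable ℂ fun z : ι → ℂ => ∏ i, z i ^ α i := by
  classical
  intro z
  exact (HasFDerivAt.finsetProd (u := Finset.univ) (g := fun i (z : ι → ℂ) => z i ^ α i)
    fun i _ => ((differentiableAt_apply i z).pow (α i)).hasFDerivAt).differentiableAt

/-- The monomial `z^α` as an element of the Bergman space. -/
noncomputable def monomial (hlam : -1 < lam) (α : ι → ℕ) : bergman ι lam :=
  ⟨(memLp_monomial hlam α).toLp _, fun z => ∏ i, z i ^ α i,
    (differentiable_monomial α).differentiableOn, (memLp_monomial hlam α).coeFn_toLp⟩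

lemma memLp_top_weighted {φ : (ι → ℂ) → ℂ} (hφ : MemLp φ ∞ (volume.restrict (unitBall ι))) :
    MemLp φ ∞ (weightedMeasure ι lam) := by
  have hac : weightedMeasure ι lam ≪ volume.restrict (unitBall ι) :=
    withDensity_absolutelyContinuous _ _
  refine ⟨hφ.1.mono_ac hac, ?_⟩
  have h := hφ.2
  rw [eLpNorm_exponent_top] at h ⊢
  exact (eLpNormEssSup_mono_measure φ hac).trans_lt h

variable (lam)

/-- The Bergman projection: the orthogonal projection of `L²(dv_λ)` onto the Bergman space. -/
noncomputable def bergmanProjection :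
    Lp ℂ 2 (weightedMeasure ι lam) →L[ℂ] bergman ι lam :=
  (bergman ι lam).orthogonalProjectionOnto

/-- Multiplication by a function in `L_∞`, as an operator on `L²(dv_λ)`. -/
noncomputable def mulOperator {φ : (ι → ℂ) → ℂ}
    (hφ : MemLp φ ∞ (volume.restrict (unitBall ι))) :
    Lp ℂ 2 (weightedMeasure ι lam) →L[ℂ] Lp ℂ 2 (weightedMeasure ι lam) :=
  (ContinuousLinearMap.mul ℂ ℂ).holderL (weightedMeasure ι lam) ∞ 2 2
    ((memLp_top_weighted (lam := lam) hφ).toLp φ)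

/-- The Toeplitz operator `T_φ f = B_λ(φ f)` with symbol `φ ∈ L_∞`. -/
noncomputable def toeplitz {φ : (ι → ℂ) → ℂ}
    (hφ : MemLp φ ∞ (volume.restrict (unitBall ι))) : bergman ι lam →L[ℂ] bergman ι lam :=
  bergmanProjection lam ∘L mulOperator lam hφ ∘L (bergman ι lam).subtypeL

end Bergman

/-! ### Block coordinates and symbols

The coordinates of `ℂ^n = ℂ^{k_1} × ⋯ × ℂ^{k_m}` are indexed by the pairs `⟨j, l⟩` with `j : Fin m`
and `l : Fin (k j)`, so `z ⟨j, l⟩` is `z_{j,l}` and `n = ∑ j, k j`. -/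

section Symbols

variable {m : ℕ} {k : Fin m → ℕ}

/-- The common radii `r_j = (∑_l |z_{j,l}|²)^{1/2}`. -/
noncomputable def radii (z : (Σ j, Fin (k j)) → ℂ) (j : Fin m) : ℝ :=
  √(∑ l, ‖z ⟨j, l⟩‖ ^ 2)

/-- The spherical part `s_{(j)}`, with `s_{j,l} = |z_{j,l}| / r_j`. -/
noncomputable def sphericalPart (z : (Σ j, Fin (k j)) → ℂ) (j : Fin m) : Fin (k j) → ℝ :=
  fun l => ‖z ⟨j, l⟩‖ / radii z j

/-- The torus part `t_{(j)}`, with `t_{j,l} = z_{j,l} / |z_{j,l}|`. -/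
noncomputable def torusPart (z : (Σ j, Fin (k j)) → ℂ) (j : Fin m) : Fin (k j) → ℂ :=
  fun l => z ⟨j, l⟩ / ‖z ⟨j, l⟩‖

/-- A function `a` of the radii `(r_1, …, r_m)` such that `z ↦ a(r_1, …, r_m)` lies in `L_∞` of
the unit ball, that is, such that this function of `z` is a `k`-quasi-radial symbol. -/
def IsQuasiRadial (k : Fin m → ℕ) (a : (Fin m → ℝ) → ℂ) : Prop :=
  MemLp (fun z : (Σ j, Fin (k j)) → ℂ => a (radii z)) ∞
    (volume.restrict (unitBall (Σ j, Fin (k j))))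

/-- The surface measure of the unit sphere of `ℝ^d` restricted to
`S_+^{d-1} = S^{d-1} ∩ ℝ_+^d`, as a measure on `ℝ^d`. -/
noncomputable def sphereMeasure (d : ℕ) : Measure (Fin d → ℝ) :=
  ((volume : Measure (EuclideanSpace ℝ (Fin d))).toSphere.map
    fun x : Metric.sphere (0 : EuclideanSpace ℝ (Fin d)) 1 => x.val.ofLp).restrict {s | ∀ l, 0 ≤ s l}

/-- The normalized invariant measure `(2π)⁻¹ dt / (i t)` of the unit circle, as a measure
on `ℂ`. -/
noncomputable def circleMeasure : Measure ℂ :=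
  ENNReal.ofReal (2 * Real.pi)⁻¹ •
    (volume.restrict (Set.Ioc 0 (2 * Real.pi))).map fun θ : ℝ => Complex.exp (θ * Complex.I)

/-- The invariant probability measure of the torus `𝕋^d`, as a measure on `ℂ^d`. -/
noncomputable def torusMeasure (d : ℕ) : Measure (Fin d → ℂ) :=
  Measure.pi fun _ => circleMeasure

/-- The measure of `S_+^{d-1} × 𝕋^d`, as a measure on `ℝ^d × ℂ^d`. -/
noncomputable def sphereTorusMeasure (d : ℕ) : Measure ((Fin d → ℝ) × (Fin d → ℂ)) :=
  (sphereMeasure d).prod (torusMeasure d)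

/-- Generalized pseudo-homogeneous functions: `c ∈ L_∞(S_+^{d-1} × 𝕋^d)` with
`c(s, g t) = c(s, t)` for all `g ∈ 𝕋`. Elements of `L_∞` are classes of functions, so the
identity is required almost everywhere. The values of `c` off `S_+^{d-1} × 𝕋^d`, which is a null
set for the measure, play no role. -/
def IsGenPseudoHomogeneous (d : ℕ) (c : (Fin d → ℝ) × (Fin d → ℂ) → ℂ) : Prop :=
  MemLp c ∞ (sphereTorusMeasure d) ∧
    ∀ g : ℂ, ‖g‖ = 1 → ∀ᵐ x ∂sphereTorusMeasure d, c (x.1, fun l => g * x.2 l) = c x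

/-- The symbol `a c` on the unit ball, with `c = ∏_j c_j(s_{(j)}, t_{(j)})`. -/
noncomputable def symbol (a : (Fin m → ℝ) → ℂ)
    (c : ∀ j, (Fin (k j) → ℝ) × (Fin (k j) → ℂ) → ℂ) (z : (Σ j, Fin (k j)) → ℂ) : ℂ :=
  a (radii z) * ∏ j, c j (sphericalPart z j, torusPart z j)

/-- `|α_{(j)}| = ∑_l α_{j,l}`. -/
def blockDegree (α : (Σ j, Fin (k j)) → ℕ) (j : Fin m) : ℕ := ∑ l, α ⟨j, l⟩

/-- The Fourier coefficient `ĉ(s, p) = ∫ c(s, t) t^{-p} dμ(t)`. -/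
noncomputable def fourierCoefficient {d : ℕ} (c : (Fin d → ℝ) × (Fin d → ℂ) → ℂ)
    (s : Fin d → ℝ) (p : Fin d → ℤ) : ℂ :=
  ∫ t, c (s, t) * ∏ l, t l ^ (-p l) ∂torusMeasure d

/-- `Δ_d = {r ∈ ℝ_+^d : r_1 + ⋯ + r_d ≤ 1}`. -/
def solidSimplex (d : ℕ) : Set (Fin d → ℝ) := {r | (∀ i, 0 ≤ r i) ∧ ∑ i, r i ≤ 1}

/-- The tuple `(s_1, …, s_{d-1}, 1 - (s_1 + ⋯ + s_{d-1}))`, for `d ≥ 1`. -/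
def complete {d : ℕ} (s : Fin (d - 1) → ℝ) (l : Fin d) : ℝ :=
  if h : l.val < d - 1 then s ⟨l.val, h⟩ else 1 - ∑ i, s i

end Symbols

end BergmanBall

/-!
In polar coordinates, taken block by block, Lebesgue measure of `ℂ^n` is a product measure. Write
`z_{j,l} = √(ρ_j x_{j,l}) t_{j,l}` with `ρ_j = r_j² > 0`, with `x_{(j)} = (s_{j,l}²)_l` in the
standard simplex of `ℝ^{k_j}`, parametrized by its first `k_j - 1` coordinates, and with `t_{(j)}`
in the torus. Then `dv = ∏_j π^{k_j} ρ_j^{k_j - 1} dρ_j dx_{(j)} dμ_j(t_{(j)})`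
(`measurePreserving_polarMap`, `measurePreserving_polarMapPi`). This comes from polar coordinates
in each copy of `ℂ`, with `|z|²` as radial variable (`measurePreserving_sqrt_mul`), and from the
substitution `u = ρ x` in the positive orthant (`measurePreserving_mul_complete`).

Since `B_λ` is an orthogonal projection, `⟨T_{ac} z^α, z^β⟩` is the integral of
`a c z^α conj(z^β)` against `dv_λ` (`inner_toeplitz_monomial`). In the coordinates above this
integrand is a function of `ρ` times a product of functions of `(x_{(j)}, t_{(j)})`, so the entry
is a product of integrals (`inner_toeplitz_symbol`).

* Rotating `t_{(j)}` by `g ∈ 𝕋` multiplies the integrand of the `j`-th angular integral by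
  `g^{|α_{(j)}| - |β_{(j)}|}`, and leaves the measure and `c_j` invariant. So the integral vanishes
  if `|α_{(j)}| ≠ |β_{(j)}|` (`integral_angularFactor_eq_zero`).
* If `β = α + p`, integrating over the torus first gives the Fourier coefficient of `c_j`
  (`integral_angularFactor`). If moreover `|p_{(j)}| = 0` for all `j`, the radial integral is the
  one over `Δ_m` (`integral_radialFactor`), and the remaining Gamma factors cancel.

The functions `c_j` are only defined almost everywhere on `S_+^{k_j - 1} × 𝕋^{k_j}`. That the symbol
is measurable and bounded, and that invariance almost everywhere may be used under the integral,
rests on two absolute continuity statements, `quasiMeasurePreserving_angles` and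
`quasiMeasurePreserving_sqrt_complete`. The second one holds because a null set of the sphere spans
a null cone.
-/

namespace BergmanBall

/-! ### Product measures -/

section ProductMeasures

theorem measurePreserving_pairPi {ι : Type*} [Fintype ι] {A B : ι → Type*}
    [∀ i, MeasurableSpace (A i)] [∀ i, MeasurableSpace (B i)]
    (μ : ∀ i, Measure (A i)) (ν : ∀ i, Measure (B i))
    [∀ i, SigmaFinite (μ i)] [∀ i, SigmaFinite (ν i)] :
    MeasurePreserving (fun (x : (∀ i, A i) × (∀ i, B i)) i => (x.1 i, x.2 i))
      ((Measure.pi μ).prod (Measure.pi ν)) (Measure.pi fun i => (μ i).prod (ν i)) := by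
  have hm : Measurable (fun (x : (∀ i, A i) × (∀ i, B i)) i => (x.1 i, x.2 i)) := by fun_prop
  refine ⟨hm, (Measure.pi_eq_generateFrom (fun i => generateFrom_prod)
    (fun i => isPiSystem_prod)
    (fun i => (μ i).toFiniteSpanningSetsIn.prod (ν i).toFiniteSpanningSetsIn) ?_).symm⟩
  intro s hs
  choose u hu v hv hs using hs
  obtain rfl : (fun i => u i ×ˢ v i) = s := funext hs
  rw [Measure.map_apply hm
    (MeasurableSet.univ_pi fun i => MeasurableSet.prod (hu i) (hv i))]
  have : (fun (x : (∀ i, A i) × (∀ i, B i)) i => (x.1 i, x.2 i)) ⁻¹'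
      (Set.univ.pi fun i => u i ×ˢ v i) = (Set.univ.pi u) ×ˢ (Set.univ.pi v) := by
    ext x
    simp [Set.mem_pi, forall_and]
  rw [this, Measure.prod_prod, Measure.pi_pi, Measure.pi_pi, ← Finset.prod_mul_distrib]
  simp_rw [Measure.prod_prod]

theorem lintegral_fin_pi_prod {n : ℕ} {A : Type*} [MeasurableSpace A]
    (μ : Fin n → Measure A) [∀ i, SigmaFinite (μ i)] {f : Fin n → A → ℝ≥0∞}
    (hf : ∀ i, Measurable (f i)) :
    ∫⁻ x, ∏ i, f i (x i) ∂Measure.pi μ = ∏ i, ∫⁻ x, f i x ∂μ i := by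
  induction n with
  | zero => simp
  | succ n ih =>
    have hs : Measurable fun x : Fin n → A => ∏ i, f i.succ (x i) :=
      Finset.measurable_prod _ fun i _ => (hf i.succ).comp (measurable_pi_apply i)
    have h := (measurePreserving_piFinSuccAbove μ 0).lintegral_comp
      (f := fun z : A × (Fin n → A) => f 0 z.1 * ∏ i, f i.succ (z.2 i))
      (((hf 0).comp measurable_fst).mul (hs.comp measurable_snd))
    rw [Fin.prod_univ_succ, ← ih (fun i => μ i.succ) fun i => hf i.succ,
      ← lintegral_prod_mul (hf 0).aemeasurable hs.aemeasurable]
    refine Eq.trans (lintegral_congr fun x => ?_) h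
    rw [Fin.prod_univ_succ]
    rfl

theorem pi_withDensity {n : ℕ} {A : Type*} [MeasurableSpace A]
    (μ : Fin n → Measure A) [∀ i, SigmaFinite (μ i)] {f : Fin n → A → ℝ≥0∞}
    (hf : ∀ i, Measurable (f i)) [∀ i, SigmaFinite ((μ i).withDensity (f i))] :
    Measure.pi (fun i => (μ i).withDensity (f i)) =
      (Measure.pi μ).withDensity fun x => ∏ i, f i (x i) := by
  refine Measure.pi_eq fun s hs => ?_
  rw [withDensity_apply _ (MeasurableSet.univ_pi hs), Measure.restrict_pi_pi,
    lintegral_fin_pi_prod _ hf]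
  exact Finset.prod_congr rfl fun i _ => (withDensity_apply _ (hs i)).symm

theorem measurePreserving_sigmaUncurry {ι : Type*} [Fintype ι] {κ : ι → Type*}
    [∀ i, Fintype (κ i)] {A : Type*} [MeasurableSpace A] (μ : Measure A) [SigmaFinite μ] :
    MeasurePreserving (fun (x : ∀ i, κ i → A) (q : Σ i, κ i) => x q.1 q.2)
      (Measure.pi fun i => Measure.pi fun _ : κ i => μ) (Measure.pi fun _ : Σ i, κ i => μ) := by
  have hm : Measurable (fun (x : ∀ i, κ i → A) (q : Σ i, κ i) => x q.1 q.2) := by fun_prop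
  refine ⟨hm, (Measure.pi_eq fun s hs => ?_).symm⟩
  rw [Measure.map_apply hm (MeasurableSet.univ_pi hs)]
  have : (fun (x : ∀ i, κ i → A) (q : Σ i, κ i) => x q.1 q.2) ⁻¹' Set.univ.pi s =
      Set.univ.pi fun i => Set.univ.pi fun j => s ⟨i, j⟩ := by
    ext x
    simp [Set.mem_pi, Sigma.forall]
  rw [this, Measure.pi_pi]
  simp_rw [Measure.pi_pi]
  rw [Fintype.prod_sigma]

end ProductMeasures

/-! ### The circle and the torus -/

section Circle

/-- The circle measure is the image of Lebesgue measure over any period. -/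
theorem circleMeasure_eq (a : ℝ) :
    circleMeasure = ENNReal.ofReal (2 * Real.pi)⁻¹ •
      (volume.restrict (Set.Ioc a (a + 2 * Real.pi))).map
        fun θ : ℝ => Complex.exp (θ * Complex.I) := by
  have : Fact (0 < 2 * Real.pi) := ⟨Real.two_pi_pos⟩
  have key : ∀ b : ℝ, (volume.restrict (Set.Ioc b (b + 2 * Real.pi))).map
      (fun θ : ℝ => Complex.exp (θ * Complex.I)) =
      (volume : Measure (AddCircle (2 * Real.pi))).map fun x => (AddCircle.toCircle x : ℂ) := by
    intro b
    have h := AddCircle.measurePreserving_mk (2 * Real.pi) b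
    have hc : Measurable fun x : AddCircle (2 * Real.pi) => (AddCircle.toCircle x : ℂ) :=
      (continuous_subtype_val.comp AddCircle.continuous_toCircle).measurable
    rw [← h.map_eq, Measure.map_map hc h.measurable]
    congr 1
    ext θ
    simp [AddCircle.toCircle_apply_mk, Circle.coe_exp]
  rw [key, circleMeasure, ← key 0, zero_add]

instance : IsProbabilityMeasure circleMeasure := by
  constructor
  rw [circleMeasure, Measure.smul_apply, Measure.map_apply (by fun_prop) .univ, Set.preimage_univ,
    Measure.restrict_apply_univ, Real.volume_Ioc, sub_zero, smul_eq_mul,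
    ← ENNReal.ofReal_mul (by positivity), inv_mul_cancel₀ Real.two_pi_pos.ne', ENNReal.ofReal_one]

instance (d : ℕ) : IsProbabilityMeasure (torusMeasure d) := by
  unfold torusMeasure; infer_instance

theorem ae_norm_eq_one_circleMeasure : ∀ᵐ t ∂circleMeasure, ‖t‖ = 1 := by
  refine Measure.ae_smul_measure ?_ _
  refine (ae_map_iff (by fun_prop) (measurableSet_eq_fun (by fun_prop) (by fun_prop))).2 ?_
  exact ae_of_all _ fun θ => Complex.norm_exp_ofReal_mul_I θ

theorem ae_norm_eq_one_torusMeasure (d : ℕ) : ∀ᵐ t ∂torusMeasure d, ∀ l, ‖t l‖ = 1 := by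
  refine ae_all_iff.2 fun l => ?_
  exact (Measure.quasiMeasurePreserving_eval (fun _ => circleMeasure) l).ae ae_norm_eq_one_circleMeasure

theorem measurePreserving_mul_circleMeasure {g : ℂ} (hg : ‖g‖ = 1) :
    MeasurePreserving (fun t => g * t) circleMeasure circleMeasure := by
  refine ⟨by fun_prop, ?_⟩
  obtain ⟨φ, rfl⟩ : ∃ φ : ℝ, g = Complex.exp (φ * Complex.I) :=
    ⟨g.arg, by simpa [hg] using (Complex.norm_mul_exp_arg_mul_I g).symm⟩
  conv_rhs => rw [circleMeasure_eq φ]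
  rw [circleMeasure, Measure.map_smul, Measure.map_map (by fun_prop) (by fun_prop)]
  congr 1
  have h : MeasurePreserving (fun θ : ℝ => φ + θ) (volume.restrict (Set.Ioc 0 (2 * Real.pi)))
      (volume.restrict (Set.Ioc φ (φ + 2 * Real.pi))) := by
    have := (measurePreserving_add_left volume φ).restrict_preimage
      (measurableSet_Ioc (a := φ) (b := φ + 2 * Real.pi))
    convert! this using 2
    simp
  rw [← h.map_eq, Measure.map_map (by fun_prop) (by fun_prop)]
  congr 1
  ext θ
  simp [← Complex.exp_add, add_mul]

theorem measurePreserving_mul_torusMeasure (d : ℕ) {g : ℂ} (hg : ‖g‖ = 1) :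
    MeasurePreserving (fun (t : Fin d → ℂ) l => g * t l) (torusMeasure d) (torusMeasure d) :=
  measurePreserving_pi _ _ fun _ => measurePreserving_mul_circleMeasure hg

end Circle

/-! ### Polar coordinates -/

section Polar

/-- Lebesgue measure on `(0, ∞)` under `u ↦ √u` has density `2 r dr`. -/
theorem lintegral_sqrt (f : ℝ → ℝ≥0∞) :
    ∫⁻ u in Set.Ioi 0, f √u = ∫⁻ r in Set.Ioi 0, ENNReal.ofReal (2 * r) * f r := by
  have himg : (fun r : ℝ => r ^ 2) '' Set.Ioi 0 = Set.Ioi 0 := by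
    ext u
    constructor
    · rintro ⟨r, hr, rfl⟩
      exact pow_pos (Set.mem_Ioi.1 hr) 2
    · intro hu
      exact ⟨√u, Real.sqrt_pos.2 hu, Real.sq_sqrt (le_of_lt hu)⟩
  have := lintegral_image_eq_lintegral_deriv_mul_of_monotoneOn
    (f := fun r : ℝ => r ^ 2) (f' := fun r => 2 * r) (measurableSet_Ioi (a := (0 : ℝ)))
    (fun x _ => by simpa using (hasDerivAt_pow 2 x).hasDerivWithinAt)
    (fun x hx y _ hxy => pow_le_pow_left₀ (le_of_lt hx) hxy 2) (fun u => f √u)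
  rw [himg] at this
  rw [this]
  refine setLIntegral_congr_fun measurableSet_Ioi fun r hr => ?_
  simp only [Real.sqrt_sq (le_of_lt (Set.mem_Ioi.1 hr))]

/-- Polar coordinates of `ℂ`, with the square of the modulus as radial variable. -/
theorem measurePreserving_sqrt_mul :
    MeasurePreserving (fun x : ℝ × ℂ => (√x.1 : ℂ) * x.2)
      (((volume.restrict (Set.Ioi 0)).withDensity fun _ => ENNReal.ofReal Real.pi).prod
        circleMeasure) volume := by
  have hm : Measurable (fun x : ℝ × ℂ => (√x.1 : ℂ) * x.2) := by fun_prop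
  refine ⟨hm, Measure.ext_of_lintegral _ fun f hf => ?_⟩
  have hp : ∫⁻ z : ℂ, f z = ∫⁻ r in Set.Ioi 0, ∫⁻ θ in Set.Ioo (-Real.pi) Real.pi,
      ENNReal.ofReal r * f (r * Complex.exp (θ * Complex.I)) := by
    have hF : Measurable fun q : ℝ × ℝ =>
        ENNReal.ofReal q.1 * f (q.1 * Complex.exp (q.2 * Complex.I)) := by fun_prop
    rw [← Complex.lintegral_comp_polarCoord_symm, polarCoord_target, Measure.volume_eq_prod,
      ← setLIntegral_prod _ hF.aemeasurable]
    refine lintegral_congr fun q => ?_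
    rw [Complex.polarCoord_symm_apply, Complex.exp_mul_I, smul_eq_mul]
    simp
  have hfm : Measurable fun x : ℝ × ℂ => f ((√x.1 : ℂ) * x.2) := hf.comp hm
  rw [lintegral_map hf hm, lintegral_prod _ hfm.aemeasurable, hp,
    lintegral_withDensity_eq_lintegral_mul _ measurable_const hfm.lintegral_prod_right']
  have h1 : ∀ r : ℝ, ∫⁻ t, f ((r : ℂ) * t) ∂circleMeasure =
      ENNReal.ofReal (2 * Real.pi)⁻¹ * ∫⁻ θ in Set.Ioo (-Real.pi) Real.pi,
        f (r * Complex.exp (θ * Complex.I)) := by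
    intro r
    rw [circleMeasure_eq (-Real.pi), lintegral_smul_measure,
      lintegral_map (by fun_prop) (by fun_prop), smul_eq_mul,
      show -Real.pi + 2 * Real.pi = Real.pi by ring, restrict_Ioo_eq_restrict_Ioc]
  simp only [Pi.mul_apply, h1]
  rw [lintegral_sqrt fun r => ENNReal.ofReal Real.pi * (ENNReal.ofReal (2 * Real.pi)⁻¹ *
    ∫⁻ θ in Set.Ioo (-Real.pi) Real.pi, f (r * Complex.exp (θ * Complex.I)))]
  refine setLIntegral_congr_fun measurableSet_Ioi fun r hr => ?_
  have hr0 : 0 < r := hr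
  rw [← mul_assoc, ← mul_assoc, ← ENNReal.ofReal_mul (by positivity),
    ← ENNReal.ofReal_mul (by positivity), ← lintegral_const_mul _ (by fun_prop)]
  have : 2 * r * Real.pi * (2 * Real.pi)⁻¹ = r := by
    field_simp
  rw [this]

end Polar

/-! ### Simplex coordinates -/

section Simplex

theorem measurable_complete {d : ℕ} :
    Measurable fun (x : Fin (d - 1) → ℝ) (l : Fin d) => complete x l := by
  refine measurable_pi_iff.2 fun l => ?_
  unfold complete
  split_ifs <;> fun_prop

theorem measurableSet_solidSimplex (d : ℕ) : MeasurableSet (solidSimplex d) := by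
  unfold solidSimplex
  measurability

theorem complete_nonneg {d : ℕ} {x : Fin (d - 1) → ℝ} (hx : x ∈ solidSimplex (d - 1))
    (l : Fin d) : 0 ≤ complete x l := by
  unfold complete
  split_ifs
  · exact hx.1 _
  · exact sub_nonneg.2 hx.2

theorem complete_succ {e : ℕ} (x : Fin e → ℝ) :
    complete (d := e + 1) x = Fin.snoc (α := fun _ => ℝ) x (1 - ∑ i, x i) := by
  ext l
  refine Fin.lastCases ?_ (fun i => ?_) l
  · simp [complete]
  · simp [complete]

theorem sum_complete {d : ℕ} (hd : 1 ≤ d) (x : Fin (d - 1) → ℝ) : ∑ l, complete x l = 1 := by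
  obtain ⟨e, rfl⟩ := Nat.exists_eq_add_of_le' hd
  rw [complete_succ, Fin.sum_univ_castSucc]
  simp

theorem isFiniteMeasure_restrict_solidSimplex (d : ℕ) :
    IsFiniteMeasure ((volume : Measure (Fin d → ℝ)).restrict (solidSimplex d)) := by
  refine isFiniteMeasure_restrict.2 (ne_of_lt ?_)
  refine (measure_mono (t := Set.Icc 0 1) fun x hx => ⟨fun i => hx.1 i, fun i => ?_⟩).trans_lt
    isCompact_Icc.measure_lt_top
  exact (Finset.single_le_sum (fun i _ => hx.1 i) (Finset.mem_univ i)).trans hx.2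

theorem pi_restrict_Ioi (d : ℕ) :
    Measure.pi (fun _ : Fin d => (volume : Measure ℝ).restrict (Set.Ioi 0)) =
      volume.restrict {u | ∀ i, 0 ≤ u i} := by
  rw [← Measure.restrict_pi_pi, ← volume_pi]
  exact Measure.restrict_congr_set (Measure.univ_pi_Ioi_ae_eq_Ici
    (μ := fun _ : Fin d => (volume : Measure ℝ)) (f := fun _ => 0))

/-- The change of variables `u = ρ x`, with `ρ = u_1 + ⋯ + u_d` and `x` in the simplex, has
Jacobian `ρ^{d-1}`. -/
theorem measurePreserving_mul_complete_succ (e : ℕ) :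
    MeasurePreserving
      (fun (x : ℝ × (Fin e → ℝ)) (l : Fin (e + 1)) => x.1 * complete (d := e + 1) x.2 l)
      (((volume.restrict (Set.Ioi 0)).withDensity fun ρ => ENNReal.ofReal (ρ ^ e)).prod
        (volume.restrict (solidSimplex e)))
      (Measure.pi fun _ => volume.restrict (Set.Ioi 0)) := by
  have hm : Measurable
      (fun (x : ℝ × (Fin e → ℝ)) (l : Fin (e + 1)) => x.1 * complete (d := e + 1) x.2 l) := by
    refine measurable_pi_iff.2 fun l => measurable_fst.mul ?_
    exact (measurable_pi_iff.1 (measurable_complete (d := e + 1)) l).comp measurable_snd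
  refine ⟨hm, Measure.ext_of_lintegral _ fun f hf => ?_⟩
  have := isFiniteMeasure_restrict_solidSimplex e
  set E := MeasurableEquiv.piFinSuccAbove (fun _ : Fin (e + 1) => ℝ) (Fin.last e) with hE
  set F : ℝ × (Fin e → ℝ) → ℝ≥0∞ := fun z => f (E.symm z) with hF
  have hFm : Measurable F := hf.comp E.symm.measurable
  set P : Set (Fin e → ℝ) := {y | ∀ i, 0 ≤ y i} with hP
  have hPm : MeasurableSet P := by
    rw [hP]; measurability
  have hPae := pi_restrict_Ioi e
  -- the right-hand side, with the last coordinate singled out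
  have hR : ∫⁻ u, f u ∂Measure.pi (fun _ : Fin (e + 1) => (volume : Measure ℝ).restrict (Set.Ioi 0))
      = ∫⁻ y in P, ∫⁻ v in Set.Ioi 0, F (v, y) := by
    have h := (measurePreserving_piFinSuccAbove
      (fun _ : Fin (e + 1) => (volume : Measure ℝ).restrict (Set.Ioi 0)) (Fin.last e)).symm
    have h2 := h.lintegral_comp hf
    rw [← h2, hPae]
    exact lintegral_prod_symm' F hFm
  -- dilation of the simplex by `ρ`
  have hL : ∀ ρ : ℝ, 0 < ρ → ENNReal.ofReal (ρ ^ e) *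
      ∫⁻ x in solidSimplex e, f (fun l => ρ * complete (d := e + 1) x l) =
      ∫⁻ y in P, (Set.Ici 0).indicator (fun v => F (v, y)) (ρ - ∑ i, y i) := by
    intro ρ hρ
    have hmap := Measure.map_addHaar_smul (volume : Measure (Fin e → ℝ)) hρ.ne'
    have hG : Measurable fun y : Fin e → ℝ =>
        P.indicator (fun y => (Set.Ici 0).indicator (fun v => F (v, y)) (ρ - ∑ i, y i)) y := by
      refine Measurable.indicator ?_ hPm
      have : (fun y : Fin e → ℝ => (Set.Ici 0).indicator (fun v => F (v, y)) (ρ - ∑ i, y i)) =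
          ({y : Fin e → ℝ | 0 ≤ ρ - ∑ i, y i}).indicator fun y => F (ρ - ∑ i, y i, y) := by
        ext y
        rfl
      rw [this]
      refine Measurable.indicator (hFm.comp (by fun_prop)) ?_
      exact measurableSet_le measurable_const (by fun_prop)
    have h1 := lintegral_map (μ := volume) hG (measurable_const_smul ρ)
    rw [hmap, lintegral_smul_measure, lintegral_indicator hPm, Module.finrank_pi,
      Fintype.card_fin] at h1
    have h2 : ENNReal.ofReal (ρ ^ e) * ENNReal.ofReal |(ρ ^ e)⁻¹| = 1 := by
      rw [abs_of_pos (by positivity), ← ENNReal.ofReal_mul (by positivity),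
        mul_inv_cancel₀ (by positivity), ENNReal.ofReal_one]
    rw [← one_mul (∫⁻ y in P, _), ← h2, mul_assoc, ← smul_eq_mul (ENNReal.ofReal |_|), h1,
      ← lintegral_indicator (measurableSet_solidSimplex e)]
    congr 1
    refine lintegral_congr fun x => ?_
    have hsum : ∑ i, (ρ • x) i = ρ * ∑ i, x i := by simp [Finset.mul_sum]
    have hsub : ρ - ∑ i, (ρ • x) i = ρ * (1 - ∑ i, x i) := by rw [hsum]; ring
    have hmem : x ∈ solidSimplex e ↔ ρ • x ∈ P ∧ ρ - ∑ i, (ρ • x) i ∈ Set.Ici 0 := by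
      rw [hsub]
      simp [solidSimplex, hP, hρ]
    by_cases hx : x ∈ solidSimplex e
    · rw [Set.indicator_of_mem hx, Set.indicator_of_mem (hmem.1 hx).1,
        Set.indicator_of_mem (hmem.1 hx).2, hF]
      simp only
      congr 1
      rw [hsub]
      ext l
      rw [complete_succ]
      refine Fin.lastCases ?_ (fun i => ?_) l
      · simp [hE, MeasurableEquiv.piFinSuccAbove]
      · simp [hE, MeasurableEquiv.piFinSuccAbove]
    · rw [Set.indicator_of_notMem hx]
      by_cases h1 : ρ • x ∈ P
      · rw [Set.indicator_of_mem h1, Set.indicator_of_notMem fun h2 => hx (hmem.2 ⟨h1, h2⟩)]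
      · rw [Set.indicator_of_notMem h1]
  have hfm : Measurable fun x : ℝ × (Fin e → ℝ) =>
      f (fun l : Fin (e + 1) => x.1 * complete (d := e + 1) x.2 l) := hf.comp hm
  rw [hR, lintegral_map hf hm, lintegral_prod _ hfm.aemeasurable,
    lintegral_withDensity_eq_lintegral_mul _ (by fun_prop) hfm.lintegral_prod_right']
  refine (setLIntegral_congr_fun (g := fun ρ => ∫⁻ y in P,
    (Set.Ici 0).indicator (fun v => F (v, y)) (ρ - ∑ i, y i)) measurableSet_Ioi
    fun ρ hρ => hL ρ hρ).trans ?_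
  rw [lintegral_lintegral_swap]
  · refine setLIntegral_congr_fun hPm fun y hy => ?_
    have hy0 : 0 ≤ ∑ i, y i := Finset.sum_nonneg fun i _ => hy i
    rw [← lintegral_indicator measurableSet_Ioi, ← lintegral_indicator measurableSet_Ioi,
      ← lintegral_add_right_eq_self _ (∑ i, y i)]
    refine lintegral_congr_ae ?_
    filter_upwards [Measure.ae_ne volume (0 : ℝ)] with v hv
    rcases lt_or_gt_of_ne hv with h | h
    · simp [Set.indicator, h.not_ge, h.not_gt]
    · have : 0 < v + ∑ i, y i := by linarith
      simp [Set.indicator, h.le, h, this]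
  · have : (Function.uncurry fun (ρ : ℝ) (y : Fin e → ℝ) =>
        (Set.Ici 0).indicator (fun v => F (v, y)) (ρ - ∑ i, y i)) =
        ({z : ℝ × (Fin e → ℝ) | 0 ≤ z.1 - ∑ i, z.2 i}).indicator
          fun z => F (z.1 - ∑ i, z.2 i, z.2) := by
      ext z
      rfl
    rw [this]
    refine (Measurable.indicator (hFm.comp (by fun_prop)) ?_).aemeasurable
    exact measurableSet_le measurable_const (by fun_prop)

theorem measurePreserving_mul_complete {d : ℕ} (hd : 1 ≤ d) :
    MeasurePreserving (fun (x : ℝ × (Fin (d - 1) → ℝ)) (l : Fin d) => x.1 * complete x.2 l)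
      (((volume.restrict (Set.Ioi 0)).withDensity fun ρ => ENNReal.ofReal (ρ ^ (d - 1))).prod
        (volume.restrict (solidSimplex (d - 1))))
      (Measure.pi fun _ => volume.restrict (Set.Ioi 0)) := by
  obtain ⟨e, rfl⟩ := Nat.exists_eq_add_of_le' hd
  exact measurePreserving_mul_complete_succ e

end Simplex

/-! ### Polar coordinates of a block -/

section Block

/-- The radial factor `π^d ρ^{d-1} dρ` of Lebesgue measure on `ℂ^d`, in the variable `ρ = |w|²`. -/
noncomputable def radialMeasure (d : ℕ) : Measure ℝ :=
  (volume.restrict (Set.Ioi 0)).withDensity fun ρ => ENNReal.ofReal (Real.pi ^ d * ρ ^ (d - 1))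

/-- The angular factor of Lebesgue measure on `ℂ^d`: Lebesgue measure in the first `d - 1` simplex
coordinates `|w_l|² / |w|²`, times the invariant measure of the torus. -/
noncomputable def angularMeasure (d : ℕ) : Measure ((Fin (d - 1) → ℝ) × (Fin d → ℂ)) :=
  (volume.restrict (solidSimplex (d - 1))).prod (torusMeasure d)

/-- The point of `ℂ^d` with squared radius `ρ`, squared moduli `ρ · complete x` and phases `t`. -/
noncomputable def polarMap (d : ℕ) (q : ℝ × ((Fin (d - 1) → ℝ) × (Fin d → ℂ))) (l : Fin d) : ℂ :=
  (√(q.1 * complete q.2.1 l) : ℂ) * q.2.2 l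

instance (d : ℕ) : SigmaFinite (radialMeasure d) := by
  unfold radialMeasure; infer_instance

instance (d : ℕ) : IsFiniteMeasure (angularMeasure d) := by
  have := isFiniteMeasure_restrict_solidSimplex (d - 1)
  unfold angularMeasure; infer_instance

theorem radialMeasure_eq_smul (d : ℕ) :
    radialMeasure d = ENNReal.ofReal (Real.pi ^ d) •
      (volume.restrict (Set.Ioi 0)).withDensity fun ρ => ENNReal.ofReal (ρ ^ (d - 1)) := by
  rw [radialMeasure, ← withDensity_smul _ (by fun_prop)]
  congr 1
  ext ρ
  rw [ENNReal.ofReal_mul (by positivity)]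
  rfl

theorem measurePreserving_polarMap {d : ℕ} (hd : 1 ≤ d) :
    MeasurePreserving (polarMap d) ((radialMeasure d).prod (angularMeasure d)) volume := by
  have := isFiniteMeasure_restrict_solidSimplex (d - 1)
  have h1 := measurePreserving_mul_complete hd
  have h2 : MeasurePreserving (fun (x : ℝ × (Fin (d - 1) → ℝ)) (l : Fin d) => x.1 * complete x.2 l)
      ((radialMeasure d).prod (volume.restrict (solidSimplex (d - 1))))
      (Measure.pi fun _ : Fin d =>
        (volume.restrict (Set.Ioi 0)).withDensity fun _ : ℝ => ENNReal.ofReal Real.pi) := by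
    refine ⟨h1.measurable, ?_⟩
    rw [pi_withDensity _ fun _ => measurable_const, withDensity_const, radialMeasure_eq_smul,
      Measure.prod_smul_left, Measure.map_smul, h1.map_eq, Finset.prod_const, Finset.card_univ,
      Fintype.card_fin, ENNReal.ofReal_pow Real.pi_pos.le]
  have h3 := h2.prod (MeasurePreserving.id (torusMeasure d))
  have h4 := (measurePreserving_pairPi
    (fun _ : Fin d => (volume.restrict (Set.Ioi 0)).withDensity fun _ : ℝ =>
      ENNReal.ofReal Real.pi) (fun _ : Fin d => circleMeasure)).comp h3
  have h5 := (measurePreserving_pi _ (fun _ : Fin d => (volume : Measure ℂ))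
    fun _ => measurePreserving_sqrt_mul).comp h4
  have h6 := (measurePreserving_prodAssoc (radialMeasure d)
    (volume.restrict (solidSimplex (d - 1))) (torusMeasure d)).symm
  exact h5.comp h6

theorem ae_pos_radialMeasure (d : ℕ) : ∀ᵐ ρ ∂radialMeasure d, 0 < ρ :=
  (withDensity_absolutelyContinuous _ _).ae_le (ae_restrict_mem measurableSet_Ioi)

theorem radialMeasure_ne_zero (d : ℕ) : radialMeasure d ≠ 0 := by
  intro h
  rw [radialMeasure, withDensity_eq_zero_iff (by fun_prop)] at h
  have h2 : ∀ᵐ ρ : ℝ ∂volume.restrict (Set.Ioi 0), False := by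
    filter_upwards [h, ae_restrict_mem measurableSet_Ioi] with ρ h1 h2
    have h3 : 0 < ρ := h2
    have : 0 < Real.pi ^ d * ρ ^ (d - 1) := by positivity
    exact (ENNReal.ofReal_pos.2 this).ne' h1
  have h3 := Measure.restrict_eq_zero.1 (ae_eq_bot.1 (eventually_false_iff_eq_bot.1 h2))
  simp at h3

instance (d : ℕ) : (ae (radialMeasure d)).NeBot := ae_neBot.2 (radialMeasure_ne_zero d)

/-- Almost every point of the simplex has positive barycentric coordinates. -/
theorem ae_complete_pos {d : ℕ} (hd : 1 ≤ d) :
    ∀ᵐ x ∂(volume : Measure (Fin (d - 1) → ℝ)).restrict (solidSimplex (d - 1)),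
      ∀ l : Fin d, 0 < complete x l := by
  have := isFiniteMeasure_restrict_solidSimplex (d - 1)
  have h1 : ∀ᵐ u ∂Measure.pi fun _ : Fin d => (volume : Measure ℝ).restrict (Set.Ioi 0),
      ∀ l, 0 < u l := ae_all_iff.2 fun l =>
    (Measure.quasiMeasurePreserving_eval (fun _ : Fin d => (volume : Measure ℝ).restrict (Set.Ioi 0))
      l).ae (ae_restrict_mem measurableSet_Ioi)
  have h2 := (measurePreserving_mul_complete hd).quasiMeasurePreserving.ae h1
  have h3 := Measure.ae_ae_of_ae_prod (h2.filter_mono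
    (Measure.AbsolutelyContinuous.prod (μ := radialMeasure d) (by
      rw [radialMeasure_eq_smul]
      exact Measure.smul_absolutelyContinuous) Measure.AbsolutelyContinuous.rfl).ae_le)
  obtain ⟨ρ, hρ, hx⟩ := ((ae_pos_radialMeasure d).and h3).exists
  filter_upwards [hx] with x hx l
  exact pos_of_mul_pos_right (hx l) hρ.le

theorem ae_angularMeasure {d : ℕ} (hd : 1 ≤ d) :
    ∀ᵐ y ∂angularMeasure d, (∀ l : Fin d, 0 < complete y.1 l) ∧ ∀ l, ‖y.2 l‖ = 1 :=
  (Measure.quasiMeasurePreserving_fst.ae (ae_complete_pos hd)).and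
    (Measure.quasiMeasurePreserving_snd.ae (ae_norm_eq_one_torusMeasure d))

section Pointwise

variable {d : ℕ} {q : ℝ × ((Fin (d - 1) → ℝ) × (Fin d → ℂ))}

theorem norm_polarMap (ht : ∀ l, ‖q.2.2 l‖ = 1) (l : Fin d) :
    ‖polarMap d q l‖ = √(q.1 * complete q.2.1 l) := by
  rw [polarMap, norm_mul, ht, mul_one, Complex.norm_real, Real.norm_of_nonneg (Real.sqrt_nonneg _)]

theorem sum_norm_sq_polarMap (hd : 1 ≤ d) (hq : 0 ≤ q.1) (hx : ∀ l : Fin d, 0 ≤ complete q.2.1 l)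
    (ht : ∀ l, ‖q.2.2 l‖ = 1) : ∑ l, ‖polarMap d q l‖ ^ 2 = q.1 := by
  simp_rw [norm_polarMap ht, fun l => Real.sq_sqrt (mul_nonneg hq (hx l))]
  rw [← Finset.mul_sum, sum_complete hd, mul_one]

theorem norm_polarMap_div (hd : 1 ≤ d) (hq : 0 < q.1) (hx : ∀ l : Fin d, 0 ≤ complete q.2.1 l)
    (ht : ∀ l, ‖q.2.2 l‖ = 1) (l : Fin d) :
    ‖polarMap d q l‖ / √(∑ l, ‖polarMap d q l‖ ^ 2) = √(complete q.2.1 l) := by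
  rw [sum_norm_sq_polarMap hd hq.le hx ht, norm_polarMap ht, Real.sqrt_mul hq.le,
    mul_div_cancel_left₀ _ (Real.sqrt_pos.2 hq).ne']

theorem polarMap_div_norm (hq : 0 < q.1) (hx : ∀ l : Fin d, 0 < complete q.2.1 l)
    (ht : ∀ l, ‖q.2.2 l‖ = 1) (l : Fin d) :
    polarMap d q l / ‖polarMap d q l‖ = q.2.2 l := by
  have : 0 < √(q.1 * complete q.2.1 l) := Real.sqrt_pos.2 (mul_pos hq (hx l))
  rw [norm_polarMap ht, polarMap, mul_div_cancel_left₀]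
  exact_mod_cast this.ne'

end Pointwise

/-! ### The sphere -/

/-- The coordinatewise square root pulls Lebesgue null sets back to null sets of the positive
orthant, as its image measure has density `∏ 2 r_l`. -/
theorem quasiMeasurePreserving_sqrt (d : ℕ) :
    Measure.QuasiMeasurePreserving (fun (u : Fin d → ℝ) l => √(u l))
      (Measure.pi fun _ => volume.restrict (Set.Ioi 0)) volume := by
  have h1 : MeasurePreserving Real.sqrt (volume.restrict (Set.Ioi 0))
      ((volume.restrict (Set.Ioi 0)).withDensity fun r => ENNReal.ofReal (2 * r)) := by
    have hm : Measurable Real.sqrt := Real.continuous_sqrt.measurable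
    refine ⟨hm, Measure.ext_of_lintegral _ fun f hf => ?_⟩
    rw [lintegral_map hf hm, lintegral_sqrt,
      lintegral_withDensity_eq_lintegral_mul _ (by fun_prop) hf]
    rfl
  have h2 := measurePreserving_pi (fun _ : Fin d => (volume : Measure ℝ).restrict (Set.Ioi 0)) _
    fun _ => h1
  refine ⟨h2.measurable, ?_⟩
  rw [h2.map_eq, pi_withDensity _ fun _ => by fun_prop]
  refine (withDensity_absolutelyContinuous _ _).trans ?_
  rw [← Measure.restrict_pi_pi, ← volume_pi]
  exact Measure.absolutelyContinuous_restrict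

/-- A null set of the spherical part spans a Lebesgue null cone. -/
theorem ae_of_sphereMeasure {d : ℕ} {s : Set (Fin d → ℝ)} (hs : MeasurableSet s)
    (h0 : sphereMeasure d s = 0) :
    ∀ᵐ u : Fin d → ℝ, u ≠ 0 → (∀ l, 0 ≤ u l) →
      (fun l => u l / √(∑ l, u l ^ 2)) ∉ s := by
  have hv : Measurable fun x : Metric.sphere (0 : EuclideanSpace ℝ (Fin d)) 1 => x.val.ofLp := by
    fun_prop
  have hpos : MeasurableSet {s : Fin d → ℝ | ∀ l, 0 ≤ s l} := by measurability
  rw [sphereMeasure, Measure.restrict_apply hs, Measure.map_apply hv (hs.inter hpos)] at h0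
  have hN : ∀ᵐ x ∂(volume : Measure (EuclideanSpace ℝ (Fin d))).toSphere,
      ¬ (x.val.ofLp ∈ s ∧ ∀ l, 0 ≤ x.val.ofLp l) := by
    rw [ae_iff]
    simp only [not_not]
    exact h0
  have h1 := (Measure.measurePreserving_homeomorphUnitSphereProd
    (volume : Measure (EuclideanSpace ℝ (Fin d)))).quasiMeasurePreserving.ae
      (Measure.quasiMeasurePreserving_fst.ae hN)
  have h2 := (ae_restrict_iff_subtype (measurableSet_singleton 0).compl
    (p := fun x : EuclideanSpace ℝ (Fin d) => (∀ l, 0 ≤ x l) →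
      (fun l => x l / √(∑ l, x l ^ 2)) ∉ s)).2 (by
    filter_upwards [h1] with x hx hx0 hxs
    refine hx ⟨?_, fun l => ?_⟩
    · convert hxs using 1
      ext l
      simp [homeomorphUnitSphereProd, homeomorphSphereProd, EuclideanSpace.norm_eq]
      ring
    · simp [homeomorphUnitSphereProd, homeomorphSphereProd]
      exact mul_nonneg (by positivity) (hx0 l))
  rw [ae_restrict_iff' (measurableSet_singleton 0).compl] at h2
  filter_upwards [(PiLp.volume_preserving_toLp (Fin d)).quasiMeasurePreserving.ae h2] with u hu hu0 hul
  exact hu (by simpa using hu0) hul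

/-- The chart `x ↦ √(complete x)` of `S_+^{d-1}` is absolutely continuous: a null set of the sphere
spans a null cone, and almost every slice `ρ = const` of a null cone is null in the simplex. -/
theorem quasiMeasurePreserving_sqrt_complete {d : ℕ} (hd : 1 ≤ d) :
    Measure.QuasiMeasurePreserving (fun (x : Fin (d - 1) → ℝ) (l : Fin d) => √(complete x l))
      (volume.restrict (solidSimplex (d - 1))) (sphereMeasure d) := by
  have := isFiniteMeasure_restrict_solidSimplex (d - 1)
  have hm : Measurable (fun (x : Fin (d - 1) → ℝ) (l : Fin d) => √(complete x l)) :=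
    measurable_pi_iff.2 fun l => (measurable_pi_iff.1 measurable_complete l).sqrt
  refine ⟨hm, Measure.AbsolutelyContinuous.mk fun s hs h0 => ?_⟩
  have h1 := (measurePreserving_mul_complete hd).quasiMeasurePreserving.ae
    ((quasiMeasurePreserving_sqrt d).ae (ae_of_sphereMeasure hs h0))
  have h3 := Measure.ae_ae_of_ae_prod (h1.filter_mono
    (Measure.AbsolutelyContinuous.prod (μ := radialMeasure d) (by
      rw [radialMeasure_eq_smul]
      exact Measure.smul_absolutelyContinuous) Measure.AbsolutelyContinuous.rfl).ae_le)
  -- the cone is invariant under dilations, so one generic slice suffices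
  obtain ⟨ρ, hρ, hx⟩ := ((ae_pos_radialMeasure d).and h3).exists
  rw [Measure.map_apply hm hs]
  refine measure_mono_null (fun x hx => ?_) (ae_iff.1 (hx.and (ae_complete_pos hd)))
  intro hxx
  obtain ⟨h4, hpos⟩ := hxx
  have hsq : √(∑ l : Fin d, √(ρ * complete x l) ^ 2) = √ρ := by
    simp_rw [fun l => Real.sq_sqrt (mul_nonneg hρ.le (hpos l).le)]
    rw [← Finset.mul_sum, sum_complete hd, mul_one]
  refine h4 (fun h5 => ?_) (fun l => Real.sqrt_nonneg _) ?_
  · have := congrFun h5 ⟨0, hd⟩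
    exact (Real.sqrt_pos.2 (mul_pos hρ (hpos ⟨0, hd⟩))).ne' this
  · simp only
    rw [hsq]
    simp_rw [Real.sqrt_mul hρ.le, mul_div_cancel_left₀ _ (Real.sqrt_pos.2 hρ).ne']
    exact hx

theorem quasiMeasurePreserving_sqrt_complete_prod {d : ℕ} (hd : 1 ≤ d) :
    Measure.QuasiMeasurePreserving
      (fun y : (Fin (d - 1) → ℝ) × (Fin d → ℂ) => ((fun l => √(complete y.1 l)), y.2))
      (angularMeasure d) (sphereTorusMeasure d) := by
  have := isFiniteMeasure_restrict_solidSimplex (d - 1)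
  have h := quasiMeasurePreserving_sqrt_complete hd
  refine ⟨(h.measurable.comp measurable_fst).prodMk measurable_snd, ?_⟩
  have h2 := Measure.map_prod_map (volume.restrict (solidSimplex (d - 1))) (torusMeasure d)
    h.measurable measurable_id
  rw [Measure.map_id] at h2
  have h3 : (angularMeasure d).map
      (fun y : (Fin (d - 1) → ℝ) × (Fin d → ℂ) => ((fun l => √(complete y.1 l)), y.2)) =
      ((volume.restrict (solidSimplex (d - 1))).map
        fun (x : Fin (d - 1) → ℝ) (l : Fin d) => √(complete x l)).prod (torusMeasure d) := h2.symm
  rw [h3]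
  exact h.absolutelyContinuous.prod Measure.AbsolutelyContinuous.rfl

/-- The pair formed by the spherical and the torus part of a point of `ℂ^d`. -/
noncomputable def blockAngles {d : ℕ} (w : Fin d → ℂ) : (Fin d → ℝ) × (Fin d → ℂ) :=
  (fun l => ‖w l‖ / √(∑ l, ‖w l‖ ^ 2), fun l => w l / ‖w l‖)

theorem quasiMeasurePreserving_blockAngles {d : ℕ} (hd : 1 ≤ d) :
    Measure.QuasiMeasurePreserving (blockAngles (d := d)) volume (sphereTorusMeasure d) := by
  have hm : Measurable (blockAngles (d := d)) := by
    unfold blockAngles; fun_prop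
  refine ⟨hm, ?_⟩
  have hP := measurePreserving_polarMap hd
  rw [← hP.map_eq, Measure.map_map hm hP.measurable]
  have h := (quasiMeasurePreserving_sqrt_complete_prod hd).comp
    (Measure.quasiMeasurePreserving_snd (μ := radialMeasure d))
  have hcongr : blockAngles ∘ polarMap d =ᵐ[(radialMeasure d).prod (angularMeasure d)]
      ((fun y : (Fin (d - 1) → ℝ) × (Fin d → ℂ) => ((fun l => √(complete y.1 l)), y.2)) ∘
        Prod.snd) := by
    filter_upwards [Measure.quasiMeasurePreserving_fst.ae (ae_pos_radialMeasure d),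
      Measure.quasiMeasurePreserving_snd.ae (ae_angularMeasure hd)] with q hq hy
    refine Prod.ext ?_ ?_
    · ext l
      exact norm_polarMap_div hd hq (fun l => (hy.1 l).le) hy.2 l
    · ext l
      exact polarMap_div_norm hq hy.1 hy.2 l
  rw [Measure.map_congr hcongr]
  exact h.absolutelyContinuous

end Block

/-! ### Matrix entries of Toeplitz operators -/

section Entries

variable {ι : Type*} [Fintype ι] {lam : ℝ}

theorem normConst_nonneg (hlam : -1 < lam) : 0 ≤ normConst ι lam := by
  have h1 : 0 < lam + 1 := by linarith
  have h2 : 0 < (Fintype.card ι : ℝ) + lam + 1 := by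
    have : (0 : ℝ) ≤ Fintype.card ι := Nat.cast_nonneg _
    linarith
  have := Real.Gamma_pos_of_pos h1
  have := Real.Gamma_pos_of_pos h2
  unfold normConst
  positivity

theorem inner_toeplitz_monomial (hlam : -1 < lam) {φ : (ι → ℂ) → ℂ}
    (hφ : MemLp φ ∞ (volume.restrict (unitBall ι))) (α β : ι → ℕ) :
    inner ℂ (monomial hlam β) (toeplitz lam hφ (monomial hlam α)) =
      ∫ z in unitBall ι, ((normConst ι lam * (1 - ∑ i, ‖z i‖ ^ 2) ^ lam : ℝ) : ℂ) *
        (φ z * ∏ i, z i ^ α i * (starRingEnd ℂ) (z i) ^ β i) := by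
  set μ := weightedMeasure ι lam with hμ
  have h1 : inner ℂ (monomial hlam β) (toeplitz lam hφ (monomial hlam α)) =
      inner ℂ (monomial hlam β : Lp ℂ 2 μ) (mulOperator lam hφ (monomial hlam α : Lp ℂ 2 μ)) :=
    Submodule.inner_orthogonalProjectionOnto_eq_of_mem_left _ _
  have h2 : (mulOperator lam hφ (monomial hlam α : Lp ℂ 2 μ) : (ι → ℂ) → ℂ) =ᵐ[μ]
      fun z => φ z * ∏ i, z i ^ α i := by
    have e1 := (ContinuousLinearMap.mul ℂ ℂ).coeFn_holder (r := 2)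
      ((memLp_top_weighted (lam := lam) hφ).toLp φ) (monomial hlam α : Lp ℂ 2 μ)
    have e2 := (memLp_top_weighted (lam := lam) hφ).coeFn_toLp
    have e3 : ((monomial hlam α : Lp ℂ 2 μ) : (ι → ℂ) → ℂ) =ᵐ[μ] fun z => ∏ i, z i ^ α i :=
      (memLp_monomial hlam α).coeFn_toLp
    filter_upwards [e1, e2, e3] with z h1 h2 h3
    rw [h2, h3] at h1
    exact h1
  have h3 : ((monomial hlam β : Lp ℂ 2 μ) : (ι → ℂ) → ℂ) =ᵐ[μ] fun z => ∏ i, z i ^ β i :=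
    (memLp_monomial hlam β).coeFn_toLp
  rw [h1, L2.inner_def]
  have h4 : ∫ z, inner ℂ ((monomial hlam β : Lp ℂ 2 μ) z)
      ((mulOperator lam hφ (monomial hlam α : Lp ℂ 2 μ) : (ι → ℂ) → ℂ) z) ∂μ =
      ∫ z, φ z * ∏ i, z i ^ α i * (starRingEnd ℂ) (z i) ^ β i ∂μ := by
    refine integral_congr_ae ?_
    filter_upwards [h2, h3] with z h2 h3
    rw [h2, h3, RCLike.inner_apply, map_prod, Finset.prod_mul_distrib]
    simp_rw [map_pow]
    ring
  refine h4.trans ?_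
  rw [hμ, weightedMeasure, integral_withDensity_eq_integral_toReal_smul (measurable_density lam)
    (ae_of_all _ fun _ => ENNReal.ofReal_lt_top)]
  refine setIntegral_congr_fun measurableSet_unitBall fun z hz => ?_
  rw [ENNReal.toReal_ofReal (mul_nonneg (normConst_nonneg hlam)
    (Real.rpow_nonneg (sub_pos.2 hz).le _)), Complex.real_smul]

end Entries

/-! ### Polar coordinates of `ℂ^n` -/

section Global

variable {m : ℕ} {k : Fin m → ℕ}

/-- The point of `ℂ^n` whose `j`-th block has squared radius `ρ_j` and angles `y_j`. -/
noncomputable def polarMapPi (k : Fin m → ℕ)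
    (x : (Fin m → ℝ) × (∀ j, (Fin (k j - 1) → ℝ) × (Fin (k j) → ℂ))) (i : Σ j, Fin (k j)) : ℂ :=
  polarMap (k i.1) (x.1 i.1, x.2 i.1) i.2

theorem measurePreserving_polarMapPi (hk : ∀ j, 1 ≤ k j) :
    MeasurePreserving (polarMapPi k)
      ((Measure.pi fun j => radialMeasure (k j)).prod (Measure.pi fun j => angularMeasure (k j)))
      volume :=
  (measurePreserving_sigmaUncurry (volume : Measure ℂ)).comp
    ((measurePreserving_pi _ _ fun j => measurePreserving_polarMap (hk j)).comp
      (measurePreserving_pairPi (fun j => radialMeasure (k j)) fun j => angularMeasure (k j)))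

theorem quasiMeasurePreserving_block (k : Fin m → ℕ) (j : Fin m) :
    Measure.QuasiMeasurePreserving (fun (z : (Σ j, Fin (k j)) → ℂ) l => z ⟨j, l⟩)
      volume volume := by
  have hm : Measurable (fun (z : (Σ j, Fin (k j)) → ℂ) (l : Fin (k j)) => z ⟨j, l⟩) := by fun_prop
  have h := measurePreserving_sigmaUncurry (κ := fun j => Fin (k j)) (volume : Measure ℂ)
  have h2 := Measure.quasiMeasurePreserving_eval
    (fun i : Fin m => Measure.pi fun _ : Fin (k i) => (volume : Measure ℂ)) j
  refine ⟨hm, ?_⟩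
  rw [volume_pi, ← h.map_eq, Measure.map_map hm h.measurable]
  exact h2.absolutelyContinuous

/-- The spherical and torus parts of a block carry Lebesgue measure of the ball to a measure
absolutely continuous with respect to that of `S_+ × 𝕋`; null sets there do not affect symbols. -/
theorem quasiMeasurePreserving_angles (hk : ∀ j, 1 ≤ k j) (j : Fin m) :
    Measure.QuasiMeasurePreserving
      (fun z : (Σ j, Fin (k j)) → ℂ => (sphericalPart z j, torusPart z j))
      (volume.restrict (unitBall (Σ j, Fin (k j)))) (sphereTorusMeasure (k j)) :=
  ((quasiMeasurePreserving_blockAngles (hk j)).comp (quasiMeasurePreserving_block k j)).mono_left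
    Measure.absolutelyContinuous_restrict

theorem memLp_top_prod {X κ : Type*} [MeasurableSpace X] {μ : Measure X} (s : Finset κ)
    {f : κ → X → ℂ} (hf : ∀ i ∈ s, MemLp (f i) ∞ μ) :
    MemLp (fun x => ∏ i ∈ s, f i x) ∞ μ := by
  classical
  induction s using Finset.induction_on with
  | empty => simpa using memLp_top_const (1 : ℂ)
  | insert i s hi ih =>
    simp_rw [Finset.prod_insert hi]
    exact (ih fun j hj => hf j (Finset.mem_insert_of_mem hj)).mul
      (hf i (Finset.mem_insert_self _ _))

theorem memLp_top_comp {X Y : Type*} [MeasurableSpace X] [MeasurableSpace Y] {μ : Measure X}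
    {ν : Measure Y} {f : X → Y} {g : Y → ℂ} (hg : MemLp g ∞ ν)
    (hf : Measure.QuasiMeasurePreserving f μ ν) : MemLp (fun x => g (f x)) ∞ μ := by
  refine memLp_top_of_bound (hg.1.comp_quasiMeasurePreserving hf) (eLpNormEssSup g ν).toReal ?_
  have h : eLpNormEssSup g ν ≠ ∞ := by
    simpa [eLpNorm_exponent_top] using hg.2.ne
  filter_upwards [hf.ae (ae_le_eLpNormEssSup (f := g))] with x hx
  simpa using ENNReal.toReal_mono h hx

theorem memLp_symbol (hk : ∀ j, 1 ≤ k j) {a : (Fin m → ℝ) → ℂ} (ha : IsQuasiRadial k a)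
    {c : ∀ j, (Fin (k j) → ℝ) × (Fin (k j) → ℂ) → ℂ}
    (hc : ∀ j, IsGenPseudoHomogeneous (k j) (c j)) :
    MemLp (symbol a c) ∞ (volume.restrict (unitBall (Σ j, Fin (k j)))) :=
  (memLp_top_prod Finset.univ fun j _ =>
    memLp_top_comp (hc j).1 (quasiMeasurePreserving_angles hk j)).mul ha

/-- The part of the integrand of `⟨T_{ac} z^α, z^β⟩` that depends on the squared radii. -/
noncomputable def radialFactor (lam : ℝ) (a : (Fin m → ℝ) → ℂ) (α β : (Σ j, Fin (k j)) → ℕ) :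
    (Fin m → ℝ) → ℂ :=
  {ρ | ∑ j, ρ j < 1}.indicator fun ρ => a (fun j => √(ρ j)) *
    ((normConst (Σ j, Fin (k j)) lam * (1 - ∑ j, ρ j) ^ lam *
      ∏ j, √(ρ j) ^ (blockDegree α j + blockDegree β j) : ℝ) : ℂ)

/-- The part of the integrand of `⟨T_{ac} z^α, z^β⟩` that depends on the angles of one block. -/
noncomputable def angularFactor {d : ℕ} (c : (Fin d → ℝ) × (Fin d → ℂ) → ℂ) (α β : Fin d → ℕ)
    (y : (Fin (d - 1) → ℝ) × (Fin d → ℂ)) : ℂ :=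
  c (fun l => √(complete y.1 l), y.2) *
    ∏ l, (√(complete y.1 l) : ℂ) ^ (α l + β l) * (y.2 l ^ α l * (starRingEnd ℂ) (y.2 l) ^ β l)

theorem indicator_integrand_polarMapPi (lam : ℝ) (hk : ∀ j, 1 ≤ k j)
    (a : (Fin m → ℝ) → ℂ) (c : ∀ j, (Fin (k j) → ℝ) × (Fin (k j) → ℂ) → ℂ)
    (α β : (Σ j, Fin (k j)) → ℕ) {ρ : Fin m → ℝ}
    {y : ∀ j, (Fin (k j - 1) → ℝ) × (Fin (k j) → ℂ)} (hρ : ∀ j, 0 < ρ j)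
    (hy : ∀ j, (∀ l : Fin (k j), 0 < complete (y j).1 l) ∧ ∀ l, ‖(y j).2 l‖ = 1) :
    (unitBall (Σ j, Fin (k j))).indicator (fun z =>
      ((normConst (Σ j, Fin (k j)) lam * (1 - ∑ i, ‖z i‖ ^ 2) ^ lam : ℝ) : ℂ) *
        (symbol a c z * ∏ i, z i ^ α i * (starRingEnd ℂ) (z i) ^ β i)) (polarMapPi k (ρ, y)) =
      radialFactor lam a α β ρ *
        ∏ j, angularFactor (c j) (fun l => α ⟨j, l⟩) (fun l => β ⟨j, l⟩) (y j) := by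
  have hblock : ∀ j, ∑ l, ‖polarMapPi k (ρ, y) ⟨j, l⟩‖ ^ 2 = ρ j := fun j =>
    sum_norm_sq_polarMap (q := (ρ j, y j)) (hk j) (hρ j).le (fun l => ((hy j).1 l).le) (hy j).2
  have hsum : ∑ i, ‖polarMapPi k (ρ, y) i‖ ^ 2 = ∑ j, ρ j := by
    rw [Fintype.sum_sigma]
    exact Finset.sum_congr rfl fun j _ => hblock j
  have hrad : radii (polarMapPi k (ρ, y)) = fun j => √(ρ j) := by
    ext j
    rw [radii, hblock]
  have hsym : symbol a c (polarMapPi k (ρ, y)) =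
      a (fun j => √(ρ j)) * ∏ j, c j (fun l => √(complete (y j).1 l), (y j).2) := by
    rw [symbol, hrad]
    congr 1
    refine Finset.prod_congr rfl fun j _ => ?_
    congr 1
    refine Prod.ext (funext fun l => ?_) (funext fun l => ?_)
    · exact norm_polarMap_div (q := (ρ j, y j)) (hk j) (hρ j) (fun l => ((hy j).1 l).le) (hy j).2 l
    · exact polarMap_div_norm (q := (ρ j, y j)) (hρ j) (hy j).1 (hy j).2 l
  have hmon : ∏ i, polarMapPi k (ρ, y) i ^ α i * (starRingEnd ℂ) (polarMapPi k (ρ, y) i) ^ β i =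
      ((∏ j, √(ρ j) ^ (blockDegree α j + blockDegree β j) : ℝ) : ℂ) *
        ∏ j, ∏ l, (√(complete (y j).1 l) : ℂ) ^ (α ⟨j, l⟩ + β ⟨j, l⟩) *
          ((y j).2 l ^ α ⟨j, l⟩ * (starRingEnd ℂ) ((y j).2 l) ^ β ⟨j, l⟩) := by
    rw [Fintype.prod_sigma, Complex.ofReal_prod, ← Finset.prod_mul_distrib]
    refine Finset.prod_congr rfl fun j _ => ?_
    rw [blockDegree, blockDegree, ← Finset.sum_add_distrib, Complex.ofReal_pow,
      ← Finset.prod_pow_eq_pow_sum, ← Finset.prod_mul_distrib]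
    refine Finset.prod_congr rfl fun l _ => ?_
    rw [polarMapPi, polarMap, Real.sqrt_mul (hρ j).le, map_mul, Complex.conj_ofReal]
    push_cast
    ring
  simp only [radialFactor, angularFactor]
  by_cases hb : ∑ j, ρ j < 1
  · rw [Set.indicator_of_mem (show polarMapPi k (ρ, y) ∈ unitBall _ from hsum.trans_lt hb),
      Set.indicator_of_mem (show ρ ∈ {ρ : Fin m → ℝ | ∑ j, ρ j < 1} from hb), hsum, hsym, hmon,
      Finset.prod_mul_distrib]
    push_cast
    ring
  · have hn : polarMapPi k (ρ, y) ∉ unitBall (Σ j, Fin (k j)) :=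
      fun h => hb (hsum.symm.trans_lt h)
    rw [Set.indicator_of_notMem hn,
      Set.indicator_of_notMem (show ρ ∉ {ρ : Fin m → ℝ | ∑ j, ρ j < 1} from hb), zero_mul]

/-- In polar coordinates the integrand of a matrix entry separates, so the entry is a product of
one integral over the radii and one integral for each block. -/
theorem inner_toeplitz_symbol {lam : ℝ} (hlam : -1 < lam) (hk : ∀ j, 1 ≤ k j)
    {a : (Fin m → ℝ) → ℂ} {c : ∀ j, (Fin (k j) → ℝ) × (Fin (k j) → ℂ) → ℂ}
    (hac : MemLp (symbol a c) ∞ (volume.restrict (unitBall (Σ j, Fin (k j)))))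
    (α β : (Σ j, Fin (k j)) → ℕ) :
    inner ℂ (monomial hlam β) (toeplitz lam hac (monomial hlam α)) =
      (∫ ρ, radialFactor lam a α β ρ ∂Measure.pi fun j => radialMeasure (k j)) *
        ∏ j, ∫ y, angularFactor (c j) (fun l => α ⟨j, l⟩) (fun l => β ⟨j, l⟩) y
          ∂angularMeasure (k j) := by
  have hΨ := measurePreserving_polarMapPi hk
  rw [inner_toeplitz_monomial, ← integral_fintype_prod_eq_prod, ← integral_prod_mul,
    ← integral_indicator measurableSet_unitBall]
  set H : ((Σ j, Fin (k j)) → ℂ) → ℂ := (unitBall (Σ j, Fin (k j))).indicator fun z =>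
    ((normConst (Σ j, Fin (k j)) lam * (1 - ∑ i, ‖z i‖ ^ 2) ^ lam : ℝ) : ℂ) *
        (symbol a c z * ∏ i, z i ^ α i * (starRingEnd ℂ) (z i) ^ β i) with hH
  have hHm : AEStronglyMeasurable H volume := by
    refine (aestronglyMeasurable_indicator_iff measurableSet_unitBall).2 ?_
    refine AEStronglyMeasurable.mul ?_ (hac.1.mul ?_)
    · exact Measurable.aestronglyMeasurable (by fun_prop)
    · exact Measurable.aestronglyMeasurable (by fun_prop)
  rw [← hΨ.map_eq] at hHm ⊢
  rw [integral_map hΨ.measurable.aemeasurable hHm]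
  refine integral_congr_ae ?_
  have hρ : ∀ᵐ ρ ∂Measure.pi fun j => radialMeasure (k j), ∀ j, 0 < ρ j :=
    ae_all_iff.2 fun j => (Measure.quasiMeasurePreserving_eval
      (fun j => radialMeasure (k j)) j).ae (ae_pos_radialMeasure (k j))
  have hy : ∀ᵐ y ∂Measure.pi fun j => angularMeasure (k j), ∀ j,
      (∀ l : Fin (k j), 0 < complete (y j).1 l) ∧ ∀ l, ‖(y j).2 l‖ = 1 :=
    ae_all_iff.2 fun j => (Measure.quasiMeasurePreserving_eval
      (fun j => angularMeasure (k j)) j).ae (ae_angularMeasure (hk j))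
  filter_upwards [Measure.quasiMeasurePreserving_fst.ae hρ,
    Measure.quasiMeasurePreserving_snd.ae hy] with x hρ hy
  exact indicator_integrand_polarMapPi lam hk a c α β hρ hy

end Global

/-! ### The angular integrals -/

section Angular

variable {d : ℕ} {c : (Fin d → ℝ) × (Fin d → ℂ) → ℂ}

theorem integrable_angularFactor (hd : 1 ≤ d) (hc : MemLp c ∞ (sphereTorusMeasure d))
    (α β : Fin d → ℕ) : Integrable (angularFactor c α β) (angularMeasure d) := by
  have h1 := memLp_top_comp hc (quasiMeasurePreserving_sqrt_complete_prod hd)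
  have hm : Measurable fun y : (Fin (d - 1) → ℝ) × (Fin d → ℂ) =>
      ∏ l, (√(complete y.1 l) : ℂ) ^ (α l + β l) *
        (y.2 l ^ α l * (starRingEnd ℂ) (y.2 l) ^ β l) := by
    refine Finset.measurable_prod _ fun l _ => ?_
    have : Measurable fun y : (Fin (d - 1) → ℝ) × (Fin d → ℂ) => complete y.1 l :=
      (measurable_pi_iff.1 measurable_complete l).comp measurable_fst
    fun_prop
  refine ((memLp_top_of_bound hm.aestronglyMeasurable 1 ?_).mul (r := ∞) h1).integrable le_top
  filter_upwards [ae_angularMeasure hd] with y hy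
  rw [norm_prod]
  refine Finset.prod_le_one (fun _ _ => norm_nonneg _) fun l _ => ?_
  have h2 : complete y.1 l ≤ 1 := (Finset.single_le_sum (f := fun l : Fin d => complete y.1 l)
    (fun l _ => (hy.1 l).le) (Finset.mem_univ l)).trans_eq (sum_complete hd y.1)
  simp only [norm_mul, norm_pow, Complex.norm_real, RCLike.norm_conj, hy.2 l, one_pow, mul_one]
  rw [Real.norm_of_nonneg (Real.sqrt_nonneg _)]
  exact pow_le_one₀ (Real.sqrt_nonneg _) (Real.sqrt_le_one.2 h2)

/-- Rotating the torus part by `g` multiplies the integral by `g^{|α|} conj(g)^{|β|}`, while the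
measure and `c` are invariant; so the integral vanishes if `|α| ≠ |β|`. -/
theorem integral_angularFactor_eq_zero (hd : 1 ≤ d) (hc : IsGenPseudoHomogeneous d c)
    {α β : Fin d → ℕ} (h : ∑ l, α l ≠ ∑ l, β l) :
    ∫ y, angularFactor c α β y ∂angularMeasure d = 0 := by
  have := isFiniteMeasure_restrict_solidSimplex (d - 1)
  set N : ℝ := ((∑ l, α l : ℕ) : ℝ) - ((∑ l, β l : ℕ) : ℝ) with hN
  have hN0 : N ≠ 0 := sub_ne_zero.2 (by exact_mod_cast h)
  -- the rotation by `π / (|α| - |β|)` changes the sign of the integrand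
  set θ : ℝ := Real.pi / N with hθ
  set g : ℂ := Complex.exp (θ * Complex.I) with hg
  have hg1 : ‖g‖ = 1 := Complex.norm_exp_ofReal_mul_I θ
  have hgN : g ^ (∑ l, α l) * (starRingEnd ℂ) g ^ (∑ l, β l) = -1 := by
    rw [hg, ← Complex.exp_conj, ← Complex.exp_nat_mul, ← Complex.exp_nat_mul, ← Complex.exp_add,
      ← Complex.exp_pi_mul_I]
    congr 1
    have hθN : (N : ℂ) * θ = Real.pi := by
      rw [← Complex.ofReal_mul, hθ, mul_div_cancel₀ _ hN0]
    rw [map_mul, Complex.conj_ofReal, Complex.conj_I, ← hθN, hN]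
    push_cast
    ring
  have hmp : MeasurePreserving
      (fun y : (Fin (d - 1) → ℝ) × (Fin d → ℂ) => (y.1, fun l => g * y.2 l))
      (angularMeasure d) (angularMeasure d) :=
    (MeasurePreserving.id _).prod (measurePreserving_mul_torusMeasure d hg1)
  have hF := (integrable_angularFactor hd hc.1 α β).1
  have h1 : ∫ y, angularFactor c α β y ∂angularMeasure d =
      ∫ y, angularFactor c α β (y.1, fun l => g * y.2 l) ∂angularMeasure d := by
    conv_lhs => rw [← hmp.map_eq]
    rw [← hmp.map_eq] at hF
    exact integral_map hmp.measurable.aemeasurable hF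
  have h2 : ∫ y, angularFactor c α β (y.1, fun l => g * y.2 l) ∂angularMeasure d =
      ∫ y, -angularFactor c α β y ∂angularMeasure d := by
    refine integral_congr_ae ?_
    filter_upwards [(quasiMeasurePreserving_sqrt_complete_prod hd).ae (hc.2 g hg1)] with y hy
    simp only [angularFactor]
    rw [hy, neg_eq_neg_one_mul, ← hgN, ← Finset.prod_pow_eq_pow_sum, ← Finset.prod_pow_eq_pow_sum]
    simp only [Finset.prod_mul_distrib, mul_pow, map_mul]
    ring
  rw [integral_neg] at h2
  have h3 := h1.trans h2
  exact self_eq_neg.1 h3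

theorem integral_angularFactor (hd : 1 ≤ d) (hc : IsGenPseudoHomogeneous d c)
    {α β : Fin d → ℕ} {p : Fin d → ℤ} (hβ : ∀ l, (β l : ℤ) = α l + p l) :
    ∫ y, angularFactor c α β y ∂angularMeasure d =
      ∫ s in solidSimplex (d - 1), fourierCoefficient c (fun l => √(complete s l)) p *
        ((∏ l, complete s l ^ ((α l : ℝ) + (p l : ℝ) / 2) : ℝ) : ℂ) := by
  have := isFiniteMeasure_restrict_solidSimplex (d - 1)
  have hint := integrable_angularFactor hd hc.1 α β
  rw [angularMeasure] at hint ⊢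
  rw [integral_prod _ hint]
  refine setIntegral_congr_fun (measurableSet_solidSimplex _) fun s hs => ?_
  simp only [fourierCoefficient]
  rw [← integral_mul_const]
  refine integral_congr_ae ?_
  filter_upwards [ae_norm_eq_one_torusMeasure d] with t ht
  simp only [angularFactor]
  rw [mul_assoc, Complex.ofReal_prod, ← Finset.prod_mul_distrib]
  congr 1
  refine Finset.prod_congr rfl fun l _ => ?_
  have ht0 : t l ≠ 0 := by
    rw [← norm_pos_iff, ht l]; exact one_pos
  have hp : p l = (β l : ℤ) - α l := by rw [hβ l]; ring
  have h1 : t l ^ α l * (starRingEnd ℂ) (t l) ^ β l = t l ^ (-p l) := by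
    rw [← Complex.inv_eq_conj (ht l), hp, neg_sub, zpow_sub₀ ht0, zpow_natCast, zpow_natCast,
      inv_pow, div_eq_mul_inv]
  have h2 : √(complete s l) ^ (α l + β l) = complete s l ^ ((α l : ℝ) + (p l : ℝ) / 2) := by
    rw [Real.sqrt_eq_rpow, ← Real.rpow_natCast, ← Real.rpow_mul (complete_nonneg hs l), hp]
    congr 1
    push_cast
    ring
  rw [h1, ← h2, Complex.ofReal_pow]
  ring

end Angular

/-! ### The radial integral -/

section Radial

variable {m : ℕ} {k : Fin m → ℕ}

/-- The hyperplane `u_1 + ⋯ + u_m = 1` is a null set, so the open and the closed simplex carry the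
same measure. -/
theorem restrict_solidSimplex (hm : 1 ≤ m) :
    (Measure.pi fun _ : Fin m => (volume : Measure ℝ).restrict (Set.Ioi 0)).restrict
      {u | ∑ i, u i < 1} = volume.restrict (solidSimplex m) := by
  have := isFiniteMeasure_restrict_solidSimplex (m - 1)
  have h1 := measurePreserving_mul_complete hm
  have hne : ∀ᵐ u ∂Measure.pi fun _ : Fin m => (volume : Measure ℝ).restrict (Set.Ioi 0),
      ∑ i, u i ≠ 1 := by
    rw [← h1.map_eq]
    refine (ae_map_iff h1.measurable.aemeasurable ?_).2 ?_
    · exact (measurableSet_eq_fun (by fun_prop) measurable_const).compl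
    · simp_rw [← Finset.mul_sum, sum_complete hm, mul_one]
      refine Measure.quasiMeasurePreserving_fst.ae (p := fun ρ : ℝ => ρ ≠ 1) ?_
      exact (withDensity_absolutelyContinuous _ _).ae_le
        (Measure.absolutelyContinuous_restrict.ae_le (Measure.ae_ne volume (1 : ℝ)))
  have hae : {u : Fin m → ℝ | ∑ i, u i < 1} =ᵐ[Measure.pi fun _ : Fin m =>
      (volume : Measure ℝ).restrict (Set.Ioi 0)] {u | ∑ i, u i ≤ 1} := by
    filter_upwards [hne] with u hu
    exact propext ⟨fun h => le_of_lt h, fun h => lt_of_le_of_ne h hu⟩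
  rw [Measure.restrict_congr_set hae, pi_restrict_Ioi, Measure.restrict_restrict
    (measurableSet_le (by fun_prop) measurable_const), Set.inter_comm]
  rfl

theorem integral_radialFactor (hm : 1 ≤ m) (hk : ∀ j, 1 ≤ k j) (lam : ℝ) (a : (Fin m → ℝ) → ℂ)
    {α β : (Σ j, Fin (k j)) → ℕ} (hαβ : ∀ j, blockDegree β j = blockDegree α j) :
    ∫ ρ, radialFactor lam a α β ρ ∂(Measure.pi fun j => radialMeasure (k j)) =
      ((Real.Gamma ((∑ j, k j : ℕ) + lam + 1) / Real.Gamma (lam + 1) : ℝ) : ℂ) *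
        ∫ r in solidSimplex m, a (fun j => √(r j)) *
          (((∏ j, r j ^ (blockDegree α j + k j - 1)) * (1 - ∑ j, r j) ^ lam : ℝ) : ℂ) := by
  have hpi : (Measure.pi fun j => radialMeasure (k j)) =
      (Measure.pi fun _ : Fin m => (volume : Measure ℝ).restrict (Set.Ioi 0)).withDensity
        fun ρ => ∏ j, ENNReal.ofReal (Real.pi ^ k j * ρ j ^ (k j - 1)) :=
    pi_withDensity (fun _ => volume.restrict (Set.Ioi 0)) fun j => by fun_prop
  rw [hpi, integral_withDensity_eq_integral_toReal_smul (by fun_prop)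
    (ae_of_all _ fun ρ => ENNReal.prod_lt_top fun j _ => ENNReal.ofReal_lt_top)]
  have hind : ∀ ρ : Fin m → ℝ,
      (∏ j, ENNReal.ofReal (Real.pi ^ k j * ρ j ^ (k j - 1))).toReal • radialFactor lam a α β ρ =
      ({ρ : Fin m → ℝ | ∑ j, ρ j < 1}).indicator (fun ρ =>
        (∏ j, ENNReal.ofReal (Real.pi ^ k j * ρ j ^ (k j - 1))).toReal • (a (fun j => √(ρ j)) *
          ((normConst (Σ j, Fin (k j)) lam * (1 - ∑ j, ρ j) ^ lam *
            ∏ j, √(ρ j) ^ (blockDegree α j + blockDegree β j) : ℝ) : ℂ))) ρ := fun ρ => by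
    by_cases h : ρ ∈ {ρ : Fin m → ℝ | ∑ j, ρ j < 1}
    · simp only [radialFactor, Set.indicator_of_mem h]
    · simp only [radialFactor, Set.indicator_of_notMem h, smul_zero]
  simp_rw [hind]
  rw [integral_indicator (measurableSet_lt (by fun_prop) measurable_const),
    restrict_solidSimplex hm, ← integral_const_mul]
  refine setIntegral_congr_fun (measurableSet_solidSimplex m) fun r hr => ?_
  -- on the simplex `r j ≥ 0`, so neither `ofReal` nor the square roots truncate
  have h1 : (∏ j, ENNReal.ofReal (Real.pi ^ k j * r j ^ (k j - 1))).toReal =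
      Real.pi ^ (∑ j, k j) * ∏ j, r j ^ (k j - 1) := by
    rw [ENNReal.toReal_prod, ← Finset.prod_pow_eq_pow_sum, ← Finset.prod_mul_distrib]
    refine Finset.prod_congr rfl fun j _ => ENNReal.toReal_ofReal ?_
    have := hr.1 j
    positivity
  have h2 : (∏ j, r j ^ (k j - 1)) * ∏ j, √(r j) ^ (blockDegree α j + blockDegree β j) =
      ∏ j, r j ^ (blockDegree α j + k j - 1) := by
    rw [← Finset.prod_mul_distrib]
    refine Finset.prod_congr rfl fun j _ => ?_
    rw [hαβ, ← two_mul, pow_mul, Real.sq_sqrt (hr.1 j), ← pow_add]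
    congr 1
    have := hk j
    omega
  have h3 : Real.pi ^ (∑ j, k j) * normConst (Σ j, Fin (k j)) lam =
      Real.Gamma ((∑ j, k j : ℕ) + lam + 1) / Real.Gamma (lam + 1) := by
    rw [normConst, Fintype.card_sigma]
    simp only [Fintype.card_fin]
    rw [← div_div, mul_div_assoc', mul_div_cancel₀ _ (by positivity)]
  rw [h1, ← h2, ← h3, Complex.real_smul]
  push_cast
  ring

end Radial

end BergmanBall

/-! ### The Toeplitz operator with symbol `a c` on monomials -/

theorem mainTheorem7 {m : ℕ} (hm : 1 ≤ m) (k : Fin m → ℕ) (hk : ∀ j, 1 ≤ k j)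
    (lam : ℝ) (hlam : -1 < lam)
    (a : (Fin m → ℝ) → ℂ) (ha : BergmanBall.IsQuasiRadial k a)
    (c : ∀ j, (Fin (k j) → ℝ) × (Fin (k j) → ℂ) → ℂ)
    (hc : ∀ j, BergmanBall.IsGenPseudoHomogeneous (k j) (c j)) :
    ∃ hac : MemLp (BergmanBall.symbol a c) ∞
        (volume.restrict (BergmanBall.unitBall (Σ j, Fin (k j)))),
      (∀ α β : (Σ j, Fin (k j)) → ℕ,
        (∃ j, BergmanBall.blockDegree α j ≠ BergmanBall.blockDegree β j) →
          inner ℂ (BergmanBall.monomial hlam β)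
            (BergmanBall.toeplitz lam hac (BergmanBall.monomial hlam α)) = 0) ∧
      (∀ (p : (Σ j, Fin (k j)) → ℤ), (∀ j, ∑ l, p ⟨j, l⟩ = 0) →
        ∀ α β : (Σ j, Fin (k j)) → ℕ, (∀ i, (β i : ℤ) = (α i : ℤ) + p i) →
          inner ℂ (BergmanBall.monomial hlam β)
            (BergmanBall.toeplitz lam hac (BergmanBall.monomial hlam α)) =
          (((∏ i, Real.Gamma ((α i : ℝ) + (p i : ℝ) + 1)) *
              Real.Gamma ((∑ j, k j : ℕ) + lam + 1) /
              Real.Gamma ((∑ j, k j : ℕ) + (∑ i, α i : ℕ) + lam + 1) : ℝ) : ℂ) *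
          ((Real.Gamma ((∑ j, k j : ℕ) + (∑ i, α i : ℕ) + lam + 1) /
              (Real.Gamma (lam + 1) *
                ∏ j, Real.Gamma ((BergmanBall.blockDegree α j : ℝ) + k j)) : ℝ) : ℂ) *
          (∫ r in BergmanBall.solidSimplex m,
            a (fun j => √(r j)) *
              (((∏ j, r j ^ (BergmanBall.blockDegree α j + k j - 1)) *
                (1 - ∑ j, r j) ^ lam : ℝ) : ℂ)) *
          ∏ j, (((Real.Gamma ((BergmanBall.blockDegree α j : ℝ) + k j) /
                ∏ l, Real.Gamma ((α ⟨j, l⟩ : ℝ) + (p ⟨j, l⟩ : ℝ) + 1) : ℝ) : ℂ) *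
            ∫ s in BergmanBall.solidSimplex (k j - 1),
              BergmanBall.fourierCoefficient (c j)
                  (fun l => √(BergmanBall.complete s l)) (fun l => p ⟨j, l⟩) *
                ((∏ l, BergmanBall.complete s l ^
                  ((α ⟨j, l⟩ : ℝ) + (p ⟨j, l⟩ : ℝ) / 2) : ℝ) : ℂ))) := by
  have hac := BergmanBall.memLp_symbol hk ha hc
  refine ⟨hac, fun α β ⟨j, hj⟩ => ?_, fun p hp α β hβ => ?_⟩
  · rw [BergmanBall.inner_toeplitz_symbol hlam hk hac,
      Finset.prod_eq_zero (Finset.mem_univ j)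
        (BergmanBall.integral_angularFactor_eq_zero (hk j) (hc j) hj), mul_zero]
  · have hdeg : ∀ j, BergmanBall.blockDegree β j = BergmanBall.blockDegree α j := fun j => by
      have h : ∑ l, (β ⟨j, l⟩ : ℤ) = ∑ l, (α ⟨j, l⟩ : ℤ) := by
        simp_rw [hβ, Finset.sum_add_distrib, hp j, add_zero]
      exact_mod_cast h
    have hG : ∀ i, Real.Gamma ((α i : ℝ) + (p i : ℝ) + 1) ≠ 0 := fun i => by
      have h : (β i : ℝ) = (α i : ℝ) + (p i : ℝ) := by exact_mod_cast hβ i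
      rw [← h]
      exact (Real.Gamma_pos_of_pos (by positivity)).ne'
    have hD : ∀ j, Real.Gamma ((BergmanBall.blockDegree α j : ℝ) + k j) ≠ 0 := fun j => by
      have : (1 : ℝ) ≤ k j := by exact_mod_cast hk j
      exact (Real.Gamma_pos_of_pos (by positivity)).ne'
    have hG2 : Real.Gamma ((∑ j, k j : ℕ) + (∑ i, α i : ℕ) + lam + 1) ≠ 0 := by
      refine (Real.Gamma_pos_of_pos ?_).ne'
      have h1 : (0 : ℝ) ≤ (∑ j, k j : ℕ) := Nat.cast_nonneg _
      have h2 : (0 : ℝ) ≤ (∑ i, α i : ℕ) := Nat.cast_nonneg _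
      linarith
    have hG0 : Real.Gamma (lam + 1) ≠ 0 := (Real.Gamma_pos_of_pos (by linarith)).ne'
    rw [BergmanBall.inner_toeplitz_symbol hlam hk hac,
      BergmanBall.integral_radialFactor hm hk lam a hdeg, Finset.prod_mul_distrib]
    simp_rw [fun j => BergmanBall.integral_angularFactor (hk j) (hc j)
      (p := fun l => p ⟨j, l⟩) fun l => hβ ⟨j, l⟩]
    rw [← Complex.ofReal_prod, Finset.prod_div_distrib, Fintype.prod_sigma]
    -- all Gamma factors but `Γ(n + λ + 1) / Γ(λ + 1)` cancel
    have hcancel : Real.Gamma ((∑ j, k j : ℕ) + lam + 1) / Real.Gamma (lam + 1) =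
        (∏ j, ∏ l, Real.Gamma ((α ⟨j, l⟩ : ℝ) + (p ⟨j, l⟩ : ℝ) + 1)) *
          Real.Gamma ((∑ j, k j : ℕ) + lam + 1) /
          Real.Gamma ((∑ j, k j : ℕ) + (∑ i, α i : ℕ) + lam + 1) *
        (Real.Gamma ((∑ j, k j : ℕ) + (∑ i, α i : ℕ) + lam + 1) / (Real.Gamma (lam + 1) *
          ∏ j, Real.Gamma ((BergmanBall.blockDegree α j : ℝ) + k j))) *
        ((∏ j, Real.Gamma ((BergmanBall.blockDegree α j : ℝ) + k j)) /
          ∏ j, ∏ l, Real.Gamma ((α ⟨j, l⟩ : ℝ) + (p ⟨j, l⟩ : ℝ) + 1)) := by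
      have hPD := Finset.prod_ne_zero_iff.2 fun j (_ : j ∈ Finset.univ) => hD j
      have hPG := Finset.prod_ne_zero_iff.2 fun j (_ : j ∈ Finset.univ) =>
        Finset.prod_ne_zero_iff.2 fun l (_ : l ∈ Finset.univ) => hG ⟨j, l⟩
      generalize (∏ j, Real.Gamma ((BergmanBall.blockDegree α j : ℝ) + k j)) = PD at *
      generalize (∏ j, ∏ l, Real.Gamma ((α ⟨j, l⟩ : ℝ) + (p ⟨j, l⟩ : ℝ) + 1)) = PG at *
      field_simp
    rw [hcancel, Complex.ofReal_mul, Complex.ofReal_mul]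
    ring
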